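/- **Definitions.** A real matrix $S$ is a *slack matrix* of a polytope $P\subseteq\mathbb R^d$ if there is a description $P=\operatorname{conv}\{v_1,\dots,v_n\}=\{x : Ax\le b,\ A^{=}x=b^{=}\}$, where $v_1,\dots,v_n$ are the (distinct) vertices of $P$, such that $S_{ij}=b_i-A_iv_j$ for all $i,j$. A *special row* of a matrix is a $0/1$ row in which both values occur. Let $x_1$ be a special row of $S_1$ and $\overline y_1$ a special row of $S_2$. The *2-product* $(S_1,x_1)\otimes_2(S_2,\overline y_1)$ is the matrix with one column for every pair $(c_1,c_2)$ consisting of a column of $S_1$ and a column of $S_2$ whose special entries agree; this column consists of the non-special entries of $c_1$, the non-special entries of $c_2$, and the common special entry. For matrices, equality with a 2-product is understood up to permuting rows and columns. Matroids are finite, and the *base polytope* $B(M)\subseteq\mathbb R^E$ of a matroid $M$ on $E$ is the convex hull of the characteristic vectors of its bases. $M$ is *connected* if it is not the direct sum of two matroids with non-empty ground sets. For matroids $M_1,M_2$ whose ground sets $E_1',E_2'$ meet in a single element $p$ that is neither a loop nor a coloop of $M_1$ or of $M_2$, the *2-sum* $M_1\oplus_2M_2$ is the matroid on $(E_1'\cup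 E_2')\setminus\{p\}$ with bases $(B_1\cup B_2)\setminus\{p\}$, where $B_i$ is a basis of $M_i$ for $i=1,2$ and $p\in B_1\triangle B_2$. **Lemma.** Let $M$ be a connected matroid and let $S$ be a slack matrix of $B(M)$. Assume that $S=(S_1,x_1)\otimes_2(S_2,\overline y_1)$ for some real matrices $S_1,S_2$ with special rows $x_1,\overline y_1$ respectively. Let $S_1'$ be the matrix obtained from $S_1$ by appending the row $\mathbf 1-x_1$, and let $S_2'$ be the matrix obtained from $S_2$ by appending the row $\mathbf 1-\overline y_1$. Then there are matroids $M_1,M_2$ such that $M=M_1\oplus_2M_2$ and $S_i'$ is a slack matrix of $B(M_i)$ for $i=1,2$. -/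

import Mathlib

namespace TwoProd

/-- `S` is a slack matrix of the polytope `P`: `P` is the convex hull of the points `v j`, which are
its vertices, listed without repetition; `P` is the solution set of the inequalities `A i x ≤ b i`
together with finitely many equations `C l x = d l`; and `S i j` is the slack of the vertex `v j`
in the `i`-th inequality. -/
def IsSlackMatrix {ι κ V : Type*} [AddCommGroup V] [Module ℝ V]
    (S : Matrix ι κ ℝ) (P : Set V) : Prop :=
  ∃ (A : ι → V →ₗ[ℝ] ℝ) (b : ι → ℝ) (k : ℕ) (C : Fin k → V →ₗ[ℝ] ℝ) (d : Fin k → ℝ) (v : κ → V),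
    Function.Injective v ∧
    Set.range v = P.extremePoints ℝ ∧
    P = convexHull ℝ (Set.range v) ∧
    P = {x | (∀ i, A i x ≤ b i) ∧ ∀ l, C l x = d l} ∧
    ∀ i j, S i j = b i - A i (v j)

/-- Two matrices are isomorphic if they agree up to permuting rows and columns. -/
def MatrixIso {ι κ ι' κ' : Type*} (S : Matrix ι κ ℝ) (T : Matrix ι' κ' ℝ) : Prop :=
  ∃ (e : ι ≃ ι') (f : κ ≃ κ'), S = T.submatrix e f

/-- The row `x` is a special row of `S`: its entries are `0` and `1`, and both occur. -/
def IsSpecialRow {ι κ : Type*} (S : Matrix ι κ ℝ) (x : ι) : Prop :=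
  (∀ j, S x j = 0 ∨ S x j = 1) ∧ (∃ j, S x j = 0) ∧ ∃ j, S x j = 1

/-- The 2-product `(S₁, x) ⊗₂ (S₂, y)`. Its columns are the pairs of a column of `S₁` and a column
of `S₂` that both have special entry `0` (the block `S₁[0] ⊗ S₂[0]`) or both have special entry `1`
(the block `S₁[1] ⊗ S₂[1]`). Its rows are the non-special rows of `S₁`, the non-special rows of
`S₂`, and one special row. -/
def twoProduct {ι₁ κ₁ ι₂ κ₂ : Type*} (S₁ : Matrix ι₁ κ₁ ℝ) (x : ι₁) (S₂ : Matrix ι₂ κ₂ ℝ) (y : ι₂) :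
    Matrix (({i : ι₁ // i ≠ x} ⊕ {i : ι₂ // i ≠ y}) ⊕ Unit)
      {c : κ₁ × κ₂ // S₁ x c.1 = S₂ y c.2} ℝ :=
  fun i c =>
    match i with
    | Sum.inl (Sum.inl i) => S₁ i c.1.1
    | Sum.inl (Sum.inr i) => S₂ i c.1.2
    | Sum.inr _ => S₁ x c.1.1

/-- `S = (S₁, x) ⊗₂ (S₂, y)` up to isomorphism, where `x` and `y` are special rows. -/
def IsTwoProduct {ι κ ι₁ κ₁ ι₂ κ₂ : Type*} (S : Matrix ι κ ℝ)
    (S₁ : Matrix ι₁ κ₁ ℝ) (x : ι₁) (S₂ : Matrix ι₂ κ₂ ℝ) (y : ι₂) : Prop :=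
  IsSpecialRow S₁ x ∧ IsSpecialRow S₂ y ∧ MatrixIso S (twoProduct S₁ x S₂ y)

/-- The matrix `S + (𝟏 - x)`: the row `𝟏 - x` is appended to `S`, where `x` is a row of `S`. -/
def addComplRow {ι κ : Type*} (S : Matrix ι κ ℝ) (x : ι) : Matrix (ι ⊕ Unit) κ ℝ :=
  Matrix.fromRows S (Matrix.replicateRow Unit fun j => 1 - S x j)

/-- The base polytope `B(M) ⊆ ℝ^E`, the convex hull of the characteristic vectors of the bases. -/
def basePolytope {α : Type*} (M : Matroid α) : Set (M.E → ℝ) :=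
  convexHull ℝ {z | ∃ B, M.IsBase B ∧ z = fun e : M.E => B.indicator (fun _ => (1 : ℝ)) (e : α)}

/-- A (finite) matroid is connected if it is not the 1-sum (direct sum) of two matroids with
non-empty ground sets, each with fewer elements. -/
def IsConnected {α : Type*} (M : Matroid α) : Prop :=
  ¬ ∃ (M₁ M₂ : Matroid α) (h : Disjoint M₁.E M₂.E),
    M₁.E.Nonempty ∧ M₂.E.Nonempty ∧ M₁.E.ncard < M.E.ncard ∧ M₂.E.ncard < M.E.ncard ∧
      M = M₁.disjointSum M₂ h

/-- `N` is the 2-sum `M₁ ⊕₂ M₂`, whose ground sets meet in the single element `p`. -/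
def IsTwoSum {β : Type*} (N M₁ M₂ : Matroid β) (p : β) : Prop :=
  M₁.E ∩ M₂.E = {p} ∧
  ¬ M₁.IsLoop p ∧ ¬ M₁.IsColoop p ∧ ¬ M₂.IsLoop p ∧ ¬ M₂.IsColoop p ∧
  N.E = (M₁.E ∪ M₂.E) \ {p} ∧
  ∀ B, N.IsBase B ↔ ∃ B₁ B₂, M₁.IsBase B₁ ∧ M₂.IsBase B₂ ∧ p ∈ symmDiff B₁ B₂ ∧
    B = (B₁ ∪ B₂) \ {p}

end TwoProd

/-! Each row of `S` is an affine function on `ℝ^E`, and each column is a base `B(c,d)` indexed by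
columns `c`, `d` of the factors with equal special entries. Let `a` be the linear part of the
special row. As `M` is connected, any two elements lie on a circuit and are exchanged between two
bases, so their coefficients in `a` differ by -1, 0 or 1. Bases are equicardinal and the special row
is not constant, so `a` takes exactly two values, which split `E` into two classes.

Let `dir₁` and `dir₂` be the spaces of directions along which only the first, respectively the
second, component can move. They meet in 0 because a polytope is bounded. An exchange inside a class
keeps the special entry; comparing the bases `B(c,d)`, `B(c,d')`, `B(c',d)`, `B(c',d')` shows that
it moves only one component (`exchange_mem_dir`). For each of the two spaces, containing the
difference of two unit vectors is an equivalence relation on the class. Together these relations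
cover all pairs, so one of them does alone (`class_mem_dir`).

If the two classes belong to different spaces, then for a fixed special entry `c` determines the
base on one class and `d` on the other; gluing crosswise gives the 2-sum. If both belong to the same
space, the other factor has one column for each special entry, and `M` is the 2-sum of a copy of
itself with a parallel pair. In both cases `B(M)` retracts affinely onto the base polytope of each
summand, and the slacks are pulled back along this retract (`isSlackMatrix_addComplRow`). -/

namespace Matroid

open Set

variable {α : Type*} {M : Matroid α}

/-! ### Circuits, connectedness and base exchange -/

/-- If two circuits meet, then any element of the first and any element of the second lie on a
common circuit. -/
theorem exists_isCircuit_of_inter_nonempty [M.Finite] {C₁ C₂ : Set α} {x z : α}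
    (h₁ : M.IsCircuit C₁) (h₂ : M.IsCircuit C₂) (hx : x ∈ C₁) (hz : z ∈ C₂)
    (hne : (C₁ ∩ C₂).Nonempty) : ∃ C, M.IsCircuit C ∧ x ∈ C ∧ z ∈ C := by
  by_contra! hno
  have key : ∀ n : ℕ, ∀ C₁ C₂ : Set α, M.IsCircuit C₁ → M.IsCircuit C₂ → x ∈ C₁ → z ∈ C₂ →
      (C₁ ∩ C₂).Nonempty → (C₁ ∪ C₂).ncard = n → False := by
    intro n
    induction n using Nat.strong_induction_on with
    | _ n ih =>
    intro C₁ C₂ h₁ h₂ hx hz ⟨y, hy₁, hy₂⟩ hn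
    have hfin : (C₁ ∪ C₂).Finite :=
      M.ground_finite.subset (union_subset h₁.subset_ground h₂.subset_ground)
    have hx₂ : x ∉ C₂ := fun h => hno C₂ h₂ h hz
    have hz₁ : z ∉ C₁ := fun h => hno C₁ h₁ hx h
    obtain ⟨C₃, h₃s, h₃, hx₃⟩ := h₁.strong_elimination h₂ hy₁ hy₂ hx hx₂
    obtain ⟨C₄, h₄s, h₄, hz₄⟩ := h₂.strong_elimination h₁ hy₂ hy₁ hz hz₁
    have hz₃ : z ∉ C₃ := fun h => hno C₃ h₃ hx₃ h
    have hx₄ : x ∉ C₄ := fun h => hno C₄ h₄ h hz₄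
    have h₃₁ : ∃ u ∈ C₃, u ∉ C₁ := by
      by_contra! hcon
      have := h₃.eq_of_subset_isCircuit h₁ hcon
      exact (h₃s (this ▸ hy₁)).2 rfl
    have h₄₂ : ∃ u ∈ C₄, u ∉ C₂ := by
      by_contra! hcon
      have := h₄.eq_of_subset_isCircuit h₂ hcon
      exact (h₄s (this ▸ hy₂)).2 rfl
    obtain ⟨u, hu₃, hu₁⟩ := h₃₁
    obtain ⟨w, hw₄, hw₂⟩ := h₄₂
    have hu₂ : u ∈ C₂ := (h₃s hu₃).1.resolve_left hu₁
    have hw₁ : w ∈ C₁ := (h₄s hw₄).1.resolve_left hw₂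
    -- By minimality the pair `C₃`, `C₂` cannot have a smaller union. Hence `C₃` contains all of `C₁
    -- \ C₂`, so it meets `C₄` in `w`, while `C₃ ∪ C₄` misses `y`.
    have hle : n ≤ (C₃ ∪ C₂).ncard := by
      by_contra! hlt
      exact ih _ hlt C₃ C₂ h₃ h₂ hx₃ hz ⟨u, hu₃, hu₂⟩ rfl
    have hsub : C₃ ∪ C₂ ⊆ C₁ ∪ C₂ := union_subset (fun a ha => (h₃s ha).1) subset_union_right
    have heq : C₃ ∪ C₂ = C₁ ∪ C₂ := eq_of_subset_of_ncard_le hsub (hn ▸ hle) hfin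
    have hw₃ : w ∈ C₃ := by
      have : w ∈ C₃ ∪ C₂ := heq ▸ Or.inl hw₁
      exact this.resolve_right hw₂
    have hlt : (C₃ ∪ C₄).ncard < n := by
      rw [← hn]
      refine ncard_lt_ncard ⟨union_subset (fun a ha => (h₃s ha).1)
        (fun a ha => (h₄s ha).1.symm), fun h => ?_⟩ hfin
      rcases h (Or.inl hy₁) with h | h
      · exact (h₃s h).2 rfl
      · exact (h₄s h).2 rfl
    exact ih _ hlt C₃ C₄ h₃ h₄ hx₃ hz₄ ⟨w, hw₃, hw₄⟩ rfl
  exact key _ C₁ C₂ h₁ h₂ hx hz hne rfl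

/-- If every circuit lies on one side of a partition of the ground set, then the matroid is the
direct sum of its restrictions to the two sides. -/
theorem eq_disjointSum_of_circuits {X : Set α} (hX : X ⊆ M.E)
    (hC : ∀ C, M.IsCircuit C → C ⊆ X ∨ Disjoint C X) :
    M = (M ↾ X).disjointSum (M ↾ (M.E \ X)) (by simpa using disjoint_sdiff_right) := by
  refine ext_indep ?_ fun I hI => ?_
  · rw [disjointSum_ground_eq, restrict_ground_eq, restrict_ground_eq, union_sdiff_cancel hX]
  rw [disjointSum_indep_iff, restrict_indep_iff, restrict_indep_iff, restrict_ground_eq,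
    restrict_ground_eq, union_sdiff_cancel hX]
  refine ⟨fun h => ⟨⟨h.inter_right _, inter_subset_right⟩, ⟨h.inter_right _, inter_subset_right⟩,
    hI⟩, fun ⟨⟨h₁, _⟩, ⟨h₂, _⟩, _⟩ => ?_⟩
  by_contra hdep
  obtain ⟨C, hCI, hCc⟩ := ((not_indep_iff hI).1 hdep).exists_isCircuit_subset
  rcases hC C hCc with h | h
  · exact hCc.dep.not_indep (h₁.subset (subset_inter hCI h))
  · exact hCc.dep.not_indep (h₂.subset (subset_inter hCI
      (subset_sdiff.2 ⟨hCc.subset_ground, h⟩)))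

/-- Two distinct elements of a circuit can be exchanged in some base. -/
theorem IsCircuit.exists_isBase_exchange {C : Set α} {i j : α} (hC : M.IsCircuit C) (hi : i ∈ C)
    (hj : j ∈ C) (hij : i ≠ j) :
    ∃ B, M.IsBase B ∧ i ∈ B ∧ j ∉ B ∧ M.IsBase (insert j (B \ {i})) := by
  obtain ⟨B, hB, hCB⟩ := (hC.sdiff_singleton_indep hj).exists_isBase_superset
  have hjB : j ∉ B := fun h => hC.dep.not_indep (hB.indep.subset (fun a ha => by
    by_cases haj : a = j
    · exact haj ▸ h
    · exact hCB ⟨ha, haj⟩))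
  have hsub : C ⊆ insert j B := fun a ha => by
    by_cases haj : a = j
    · exact Or.inl haj
    · exact Or.inr (hCB ⟨ha, haj⟩)
  refine ⟨B, hB, hCB ⟨hi, hij⟩, hjB, hB.exchange_isBase_of_indep hjB ?_⟩
  have hCf := hC.eq_fundCircuit_of_subset hB.indep hsub
  have := (hB.indep.mem_fundCircuit_iff (by rw [hB.closure_eq]; exact hC.subset_ground hj) hjB
    (x := i)).1 (hCf ▸ hi)
  rwa [insert_sdiff_singleton_comm (Ne.symm hij)]

end Matroid

namespace TwoProd

open Set Matroid

variable {α : Type*} {M : Matroid α}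

/-- The elements sharing a circuit with `i`, and `i` itself, form a set that no circuit crosses, by
transitivity. If it missed `j`, it would split `M` into a direct sum. -/
theorem IsConnected.exists_isCircuit [M.Finite] (hM : IsConnected M) {i j : α} (hi : i ∈ M.E)
    (hj : j ∈ M.E) (hij : i ≠ j) : ∃ C, M.IsCircuit C ∧ i ∈ C ∧ j ∈ C := by
  by_contra! hno
  let X : Set α := {k | k ∈ M.E ∧ (k = i ∨ ∃ C, M.IsCircuit C ∧ i ∈ C ∧ k ∈ C)}
  have hXE : X ⊆ M.E := fun k hk => hk.1
  have hiX : i ∈ X := ⟨hi, Or.inl rfl⟩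
  have hjX : j ∉ X := by
    rintro ⟨-, h | ⟨C, hC, h₁, h₂⟩⟩
    · exact hij h.symm
    · exact hno C hC h₁ h₂
  refine hM ⟨M ↾ X, M ↾ (M.E \ X), _, ⟨i, hiX⟩, ⟨j, hj, hjX⟩, ?_, ?_,
    eq_disjointSum_of_circuits hXE ?_⟩
  · exact ncard_lt_ncard ⟨hXE, fun h => hjX (h hj)⟩ M.ground_finite
  · exact ncard_lt_ncard ⟨sdiff_subset, fun h => (h hi).2 hiX⟩ M.ground_finite
  · intro C hC
    by_cases h : Disjoint C X
    · exact Or.inr h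
    · obtain ⟨k, hkC, hkE, hk⟩ := not_disjoint_iff.1 h
      refine Or.inl fun l hl => ⟨hC.subset_ground hl, Or.inr ?_⟩
      rcases hk with rfl | ⟨C', hC', hi', hk'⟩
      · exact ⟨C, hC, hkC, hl⟩
      · exact exists_isCircuit_of_inter_nonempty hC' hC hi' hl ⟨k, hk', hkC⟩

theorem IsConnected.exists_isBase_exchange [M.Finite] (hM : IsConnected M) {i j : α}
    (hi : i ∈ M.E) (hj : j ∈ M.E) (hij : i ≠ j) :
    ∃ B, M.IsBase B ∧ i ∈ B ∧ j ∉ B ∧ M.IsBase (insert j (B \ {i})) := by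
  obtain ⟨C, hC, hiC, hjC⟩ := hM.exists_isCircuit hi hj hij
  exact hC.exists_isBase_exchange hiC hjC hij

/-! ### Cutting a matroid into the two halves of a 2-sum -/

/-- The part in `A` of a set `B`, together with the new element `none` if `B` satisfies `τ`. -/
def halfSet (τ : Set α → Prop) (A B : Set α) : Set (Option α) :=
  {o | match o with
    | some e => e ∈ B ∧ e ∈ A
    | none => τ B}

@[simp] theorem some_mem_halfSet {τ : Set α → Prop} {A B : Set α} {e : α} :
    some e ∈ halfSet τ A B ↔ e ∈ B ∧ e ∈ A := Iff.rfl

@[simp] theorem none_mem_halfSet {τ : Set α → Prop} {A B : Set α} :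
    none ∈ halfSet τ A B ↔ τ B := Iff.rfl

/-- Bases of the same type can be cut along `A` and glued crosswise. -/
def Mixes (M : Matroid α) (τ : Set α → Prop) (A : Set α) : Prop :=
  ∀ B B', M.IsBase B → M.IsBase B' → (τ B ↔ τ B') →
    M.IsBase ((B ∩ A) ∪ (B' \ A)) ∧ (τ ((B ∩ A) ∪ (B' \ A)) ↔ τ B)

/-- The half is a minor of `M`: contract the part `T` of the exchanged base outside `A`, restrict to
`A ∪ {i}`, and rename `i` to `none`. Mixing replaces the outer part of any base by `T` or `T ∪ {i}`,
according to its type. -/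
theorem exists_halfMatroid {τ : Set α → Prop} {A B : Set α} {i j : α} (hA : A ⊆ M.E)
    (hmix : Mixes M τ A) (hB : M.IsBase B) (hB' : M.IsBase (insert j (B \ {i}))) (hi : i ∈ B)
    (hj : j ∉ B) (hiA : i ∉ A) (hjA : j ∈ A) (hτ : τ B) (hτ' : ¬ τ (insert j (B \ {i}))) :
    ∃ N : Matroid (Option α), N.E = insert none (some '' A) ∧
      ∀ D, N.IsBase D ↔ ∃ B, M.IsBase B ∧ D = halfSet τ A B := by
  classical
  set B' := insert j (B \ {i}) with hB'def
  have hij : i ≠ j := fun h => hj (h ▸ hi)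
  set T := B' \ A with hT
  have hiT : i ∉ T := by simp [hT, hB'def, hij]
  have hBT : B \ A = insert i T := by
    ext e
    simp only [hT, hB'def, mem_sdiff, mem_insert_iff, mem_singleton_iff]
    grind
  have hTi : M.Indep T := hB'.indep.subset sdiff_subset
  -- The outer part determines the type: a base of type `τ` with outer part `T` would mix with `B`
  -- to a base properly contained in `B`. The next claim is the mirror image with `B'`.
  have hqi : ∀ D, M.IsBase D → D \ A = T → ¬ τ D := fun D hD hDT hτD => by
    obtain ⟨h, -⟩ := hmix B D hB hD ⟨fun _ => hτD, fun _ => hτ⟩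
    have := h.eq_of_subset_isBase hB (by rw [hDT]; grind)
    have hi' : i ∈ B ∩ A ∪ D \ A := by rw [this]; exact hi
    exact hi'.elim (fun h => hiA h.2) (fun h => hiT (hDT ▸ h))
  have hqn : ∀ D, M.IsBase D → D \ A = insert i T → τ D := fun D hD hDT => by
    by_contra hτD
    obtain ⟨h, -⟩ := hmix B' D hB' hD ⟨fun h => absurd h hτ', fun h => absurd h hτD⟩
    have := hB.eq_of_subset_isBase h (by rw [hDT]; grind)
    exact hj (by rw [this]; exact Or.inl ⟨by simp [hB'def], hjA⟩)
  have hdis : Disjoint (insert i A) T := by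
    rw [disjoint_insert_left]
    exact ⟨hiT, disjoint_sdiff_right⟩
  have hbase : ∀ D, (M ／ T).IsBase D ∧ D ⊆ insert i A ↔ M.IsBase (D ∪ T) ∧ D ⊆ insert i A := by
    intro D
    rw [hTi.contract_isBase_iff]
    exact ⟨fun h => ⟨h.1.1, h.2⟩, fun h => ⟨⟨h.1, hdis.mono_left h.2⟩, h.2⟩⟩
  have hsp : (M ／ T).Spanning (insert i A) := by
    have := (hbase (B' ∩ A)).2 ⟨by rwa [hT, inter_union_sdiff], fun e he => Or.inr he.2⟩
    exact this.1.spanning.superset this.2 (by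
      rw [contract_ground, subset_sdiff]
      exact ⟨insert_subset (hB.subset_ground hi) hA, hdis⟩)
  let g : α → Option α := fun e => if e = i then none else some e
  have hg : Function.Injective g := fun a b hab => by
    simp only [g] at hab
    split_ifs at hab <;> simp_all
  have hgs : ∀ (D : Set α) (e : α), some e ∈ g '' D ↔ e ∈ D ∧ e ≠ i := fun D e => by
    simp only [mem_image, g]
    grind
  have hgn : ∀ D : Set α, none ∈ g '' D ↔ i ∈ D := fun D => by
    simp only [mem_image, g]
    grind
  clear_value g
  refine ⟨((M ／ T) ↾ (insert i A)).map g hg.injOn, ?_, fun D => ?_⟩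
  · ext o
    rw [map_ground, restrict_ground_eq]
    cases o with
    | none => simp [hgn]
    | some e =>
      simp only [hgs, mem_insert_iff, mem_image]
      grind
  rw [map_isBase_iff]
  simp only [hsp.isBase_restrict_iff, hbase]
  constructor
  · rintro ⟨D, ⟨hD, hDs⟩, rfl⟩
    refine ⟨D ∪ T, hD, ?_⟩
    have hiff : τ (D ∪ T) ↔ i ∈ D := by
      by_cases hiD : i ∈ D
      · simp only [hiD, iff_true]
        exact hqn _ hD (by ext e; simp [hT]; grind)
      · simp only [hiD, iff_false]
        exact hqi _ hD (by ext e; simp [hT]; grind)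
    ext o
    cases o with
    | none => simp [hiff, hgn]
    | some e =>
      simp only [hgs, some_mem_halfSet, mem_union]
      grind
  · rintro ⟨D, hD, rfl⟩
    by_cases hτD : τ D
    · obtain ⟨h, -⟩ := hmix D B hD hB (by simp [hτD, hτ])
      rw [hBT] at h
      refine ⟨insert i (D ∩ A), ⟨by rwa [insert_union, ← union_insert], by grind⟩, ?_⟩
      ext o
      cases o with
      | none => simp [hτD, hgn]
      | some e =>
        simp only [hgs, some_mem_halfSet]
        grind
    · obtain ⟨h, -⟩ := hmix D B' hD hB' (by simp [hτD, hτ'])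
      refine ⟨D ∩ A, ⟨h, by grind⟩, ?_⟩
      ext o
      cases o with
      | none => simp [hgn, hτD, hiA]
      | some e =>
        simp only [hgs, some_mem_halfSet]
        grind

/-- The second half uses the negated type and the reversed exchange. Thus `none` lies in exactly one
of two half bases precisely when the bases they come from have the same type, which is when mixing
applies. -/
theorem exists_twoSum {τ : Set α → Prop} {A B : Set α} {i j : α} (hA : A ⊆ M.E)
    (hmix : Mixes M τ A) (hB : M.IsBase B) (hB' : M.IsBase (insert j (B \ {i}))) (hi : i ∈ B)
    (hj : j ∉ B) (hiA : i ∉ A) (hjA : j ∈ A) (hτ : τ B) (hτ' : ¬ τ (insert j (B \ {i}))) :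
    ∃ M₁ M₂ : Matroid (Option α),
      IsTwoSum (M.mapEmbedding Function.Embedding.some) M₁ M₂ none ∧
      M₁.E = insert none (some '' A) ∧ M₂.E = insert none (some '' (M.E \ A)) ∧
      (∀ D, M₁.IsBase D ↔ ∃ B, M.IsBase B ∧ D = halfSet τ A B) ∧
      (∀ D, M₂.IsBase D ↔ ∃ B, M.IsBase B ∧ D = halfSet (fun B => ¬ τ B) (M.E \ A) B) := by
  have hij : i ≠ j := fun h => hj (h ▸ hi)
  have hmix' : Mixes M (fun B => ¬ τ B) (M.E \ A) := by
    intro D D' hD hD' hDD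
    obtain ⟨h₁, h₂⟩ := hmix D' D hD' hD (by tauto)
    have : D ∩ (M.E \ A) ∪ D' \ (M.E \ A) = D' ∩ A ∪ D \ A := by
      have := hD.subset_ground
      have := hD'.subset_ground
      ext e; simp only [mem_union, mem_inter_iff, mem_sdiff]; grind
    rw [this]
    exact ⟨h₁, by tauto⟩
  obtain ⟨M₁, hE₁, hM₁⟩ := exists_halfMatroid hA hmix hB hB' hi hj hiA hjA hτ hτ'
  have hback : insert i (insert j (B \ {i}) \ {j}) = B := by ext e; simp; grind
  obtain ⟨M₂, hE₂, hM₂⟩ := exists_halfMatroid (M := M) (τ := fun B => ¬ τ B) (A := M.E \ A)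
    (B := insert j (B \ {i})) (i := j) (j := i) sdiff_subset hmix' hB' (by rwa [hback])
    (by simp) (by simp [hij]) (by simp [hjA]) ⟨hB.subset_ground hi, hiA⟩ hτ' (by rw [hback]; simpa)
  refine ⟨M₁, M₂, ⟨?_, ?_, ?_, ?_, ?_, ?_, ?_⟩, hE₁, hE₂, hM₁, hM₂⟩
  · rw [hE₁, hE₂]
    ext o
    cases o <;> simp
    grind
  · rw [isLoop_iff_forall_notMem_isBase (by simp [hE₁])]
    exact fun h => h _ ((hM₁ _).2 ⟨B, hB, rfl⟩) hτ
  · rw [isColoop_iff_forall_mem_isBase]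
    exact fun h => hτ' (h ((hM₁ _).2 ⟨_, hB', rfl⟩))
  · rw [isLoop_iff_forall_notMem_isBase (by simp [hE₂])]
    exact fun h => h _ ((hM₂ _).2 ⟨_, hB', rfl⟩) hτ'
  · rw [isColoop_iff_forall_mem_isBase]
    exact fun h => (h ((hM₂ _).2 ⟨_, hB, rfl⟩) : ¬ τ B) hτ
  · rw [hE₁, hE₂]
    ext o
    cases o <;> simp
    grind
  · intro D
    rw [mapEmbedding, map_isBase_iff]
    constructor
    · rintro ⟨D, hD, rfl⟩
      refine ⟨_, _, (hM₁ _).2 ⟨D, hD, rfl⟩, (hM₂ _).2 ⟨D, hD, rfl⟩, ?_, ?_⟩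
      · simp only [mem_symmDiff, none_mem_halfSet]; tauto
      · have := hD.subset_ground
        ext o
        cases o <;> simp
        grind
    · rintro ⟨D₁, D₂, hD₁, hD₂, hp, rfl⟩
      obtain ⟨B₁, hB₁, rfl⟩ := (hM₁ _).1 hD₁
      obtain ⟨B₂, hB₂, rfl⟩ := (hM₂ _).1 hD₂
      simp only [mem_symmDiff, none_mem_halfSet] at hp
      refine ⟨_, (hmix B₁ B₂ hB₁ hB₂ (by tauto)).1, ?_⟩
      have := hB₂.subset_ground
      ext o
      cases o <;> simp
      grind

/-! ### Characteristic vectors, base polytopes and slacks given by affine functions -/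

/-- The characteristic vector of `B` in `ℝ^X`. -/
noncomputable def charVec {α : Type*} (X B : Set α) : X → ℝ :=
  fun e => B.indicator (fun _ => (1 : ℝ)) (e : α)

section charVec

variable {α : Type*} {X B B' : Set α}

theorem charVec_of_mem {e : X} (h : (e : α) ∈ B) : charVec X B e = 1 := by simp [charVec, h]

theorem charVec_of_notMem {e : X} (h : (e : α) ∉ B) : charVec X B e = 0 := by simp [charVec, h]

theorem charVec_eq_one_iff {e : X} : charVec X B e = 1 ↔ (e : α) ∈ B := by
  by_cases h : (e : α) ∈ B <;> simp [charVec, h]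

theorem charVec_congr {Y : Set α} {β : Type*} {Z D : Set β} {e : Y} {f : Z}
    (h : (e : α) ∈ B ↔ (f : β) ∈ D) : charVec Y B e = charVec Z D f := by
  by_cases he : (e : α) ∈ B
  · rw [charVec_of_mem he, charVec_of_mem (h.1 he)]
  · rw [charVec_of_notMem he, charVec_of_notMem (fun h' => he (h.2 h'))]

theorem eq_of_charVec_eq (hB : B ⊆ X) (hB' : B' ⊆ X) (h : charVec X B = charVec X B') :
    B = B' := by
  ext e
  constructor
  · intro he
    have := congrFun h ⟨e, hB he⟩
    rw [charVec_of_mem he, eq_comm, charVec_eq_one_iff] at this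
    exact this
  · intro he
    have := congrFun h ⟨e, hB' he⟩
    rw [charVec_of_mem (B := B') he, charVec_eq_one_iff] at this
    exact this

theorem charVec_mem_Icc : charVec X B ∈ Set.pi univ fun _ : X => Icc (0 : ℝ) 1 := by
  intro e _
  by_cases h : (e : α) ∈ B <;> simp [charVec, h]

theorem charVec_mem_extremePoints :
    charVec X B ∈ (Set.pi univ fun _ : X => Icc (0 : ℝ) 1).extremePoints ℝ := by
  rw [extremePoints_pi]
  intro e _
  rw [mem_extremePoints_iff_left]
  refine ⟨charVec_mem_Icc e trivial, ?_⟩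
  rintro a ⟨ha₀, ha₁⟩ b ⟨hb₀, hb₁⟩ ⟨s, t, hs, ht, hst, h⟩
  simp only [smul_eq_mul] at h
  by_cases he : (e : α) ∈ B
  · rw [charVec_of_mem he] at h ⊢
    nlinarith
  · rw [charVec_of_notMem he] at h ⊢
    nlinarith

end charVec

section basePolytope

variable {α : Type*} (M : Matroid α)

theorem basePolytope_subset_cube :
    basePolytope M ⊆ Set.pi univ fun _ : M.E => Icc (0 : ℝ) 1 := by
  refine convexHull_min ?_ (convex_pi fun _ _ => convex_Icc 0 1)
  rintro _ ⟨B, -, rfl⟩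
  exact charVec_mem_Icc

variable {M} in
theorem charVec_mem_basePolytope {B : Set α} (hB : M.IsBase B) :
    charVec M.E B ∈ basePolytope M := subset_convexHull ℝ _ ⟨B, hB, rfl⟩

/-- Characteristic vectors are vertices of the unit cube, so they stay extreme in any subset of it.
-/
theorem extremePoints_basePolytope :
    (basePolytope M).extremePoints ℝ = {z | ∃ B, M.IsBase B ∧ z = charVec M.E B} := by
  refine Subset.antisymm extremePoints_convexHull_subset ?_
  rintro _ ⟨B, hB, rfl⟩
  exact inter_extremePoints_subset_extremePoints_of_subset (basePolytope_subset_cube M)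
    ⟨charVec_mem_basePolytope hB, charVec_mem_extremePoints⟩

end basePolytope

theorem isSlackMatrix_of_affineMap {ι κ τ V : Type*} [Finite τ] [AddCommGroup V] [Module ℝ V]
    {S : Matrix ι κ ℝ} {P : Set V} (f : ι → V →ᵃ[ℝ] ℝ) (g : τ → V →ᵃ[ℝ] ℝ) (v : κ → V)
    (hv : Function.Injective v) (hext : range v = P.extremePoints ℝ)
    (hP : P = convexHull ℝ (range v)) (hfg : ∀ z, (∀ i, 0 ≤ f i z) → (∀ t, g t z = 0) → z ∈ P)
    (hg : ∀ t j, g t (v j) = 0) (hS : ∀ i j, S i j = f i (v j)) (hS₀ : ∀ i j, 0 ≤ S i j) :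
    IsSlackMatrix S P := by
  obtain ⟨k, ⟨e⟩⟩ := Finite.exists_equiv_fin τ
  have hdec : ∀ (h : V →ᵃ[ℝ] ℝ) z, h z = h.linear z + h 0 := fun h z => by
    conv_lhs => rw [h.decomp]
    simp
  refine ⟨fun i => -(f i).linear, fun i => f i 0, k, fun l => (g (e.symm l)).linear,
    fun l => -(g (e.symm l) 0), v, hv, hext, hP, ?_, fun i j => ?_⟩
  · refine Subset.antisymm ?_ ?_
    · conv_lhs => rw [hP]
      refine convexHull_min ?_ ?_
      · rintro _ ⟨j, rfl⟩
        refine ⟨fun i => ?_, fun l => ?_⟩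
        · have h₁ := hS₀ i j
          rw [hS, hdec] at h₁
          simp only [LinearMap.neg_apply]
          linarith
        · have h₁ := hg (e.symm l) j
          rw [hdec] at h₁
          linarith
      · rintro a ⟨ha, ha'⟩ b ⟨hb, hb'⟩ s t hs ht hst
        refine ⟨fun i => ?_, fun l => ?_⟩
        · have h₁ := mul_le_mul_of_nonneg_left (ha i) hs
          have h₂ := mul_le_mul_of_nonneg_left (hb i) ht
          rw [map_add, map_smul, map_smul, smul_eq_mul, smul_eq_mul]
          calc _ ≤ s * f i 0 + t * f i 0 := add_le_add h₁ h₂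
            _ = f i 0 := by rw [← add_mul, hst, one_mul]
        · rw [map_add, map_smul, map_smul, ha', hb', smul_eq_mul, smul_eq_mul, ← add_mul, hst,
            one_mul]
    · rintro z ⟨h₁, h₂⟩
      refine hfg z (fun i => ?_) fun t => ?_
      · have := h₁ i
        simp only [LinearMap.neg_apply] at this
        rw [hdec]
        linarith
      · have := h₂ (e t)
        simp only [Equiv.symm_apply_apply] at this
        rw [hdec]
        linarith
  · rw [hS, hdec, LinearMap.neg_apply]
    ring

/-! ### Slack matrices in the form of a 2-product -/

variable {α ι₁ κ₁ ι₂ κ₂ : Type*}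
/-- A slack matrix of the base polytope of `M` in the form of a 2-product: the slacks are affine
functions, the rows of each factor depend on one component of a column only, and the columns are
the bases of `M`. -/
structure Glued (M : Matroid α) (S₁ : Matrix ι₁ κ₁ ℝ) (x : ι₁) (S₂ : Matrix ι₂ κ₂ ℝ) (y : ι₂) where
  /-- the slacks for the rows of the first factor -/
  row₁ : ι₁ → (M.E → ℝ) →ᵃ[ℝ] ℝ
  /-- the slacks for the rows of the second factor -/
  row₂ : ι₂ → (M.E → ℝ) →ᵃ[ℝ] ℝ
  /-- the number of equations -/
  n : ℕ
  /-- the equations -/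
  eqn : Fin n → (M.E → ℝ) →ᵃ[ℝ] ℝ
  /-- the base that belongs to a pair of columns with the same special entry -/
  base : κ₁ → κ₂ → Set α
  row_eq : row₁ x = row₂ y
  isBase : ∀ {c d}, S₁ x c = S₂ y d → M.IsBase (base c d)
  surj : ∀ {B}, M.IsBase B → ∃ c d, S₁ x c = S₂ y d ∧ base c d = B
  inj : ∀ {c d c' d'}, S₁ x c = S₂ y d → S₁ x c' = S₂ y d' → base c d = base c' d' →
    c = c' ∧ d = d'
  row₁_base : ∀ {c d} i, S₁ x c = S₂ y d → row₁ i (charVec M.E (base c d)) = S₁ i c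
  row₂_base : ∀ {c d} i, S₁ x c = S₂ y d → row₂ i (charVec M.E (base c d)) = S₂ i d
  eqn_base : ∀ {c d} l, S₁ x c = S₂ y d → eqn l (charVec M.E (base c d)) = 0
  nonneg₁ : ∀ {c d} i, S₁ x c = S₂ y d → 0 ≤ S₁ i c
  nonneg₂ : ∀ {c d} i, S₁ x c = S₂ y d → 0 ≤ S₂ i d
  mem : ∀ {u}, (∀ i, 0 ≤ row₁ i u) → (∀ i, 0 ≤ row₂ i u) → (∀ l, eqn l u = 0) →
    u ∈ basePolytope M

/-- The special rows of both factors are read off the single special row of the product. Pairs with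
different special entries are no columns; `base` gets the default value `∅` there. -/
theorem IsSlackMatrix.nonempty_glued {ι κ : Type*} {M : Matroid α} {S : Matrix ι κ ℝ}
    {S₁ : Matrix ι₁ κ₁ ℝ} {x : ι₁} {S₂ : Matrix ι₂ κ₂ ℝ} {y : ι₂}
    (hS : IsSlackMatrix S (basePolytope M)) (hiso : MatrixIso S (twoProduct S₁ x S₂ y)) :
    Nonempty (Glued M S₁ x S₂ y) := by
  classical
  obtain ⟨A, b, k, C, d, v, hv, hext, hconv, hP, hslack⟩ := hS
  obtain ⟨e, f, rfl⟩ := hiso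
  let r : ι → (M.E → ℝ) →ᵃ[ℝ] ℝ := fun i => AffineMap.const ℝ _ (b i) - (A i).toAffineMap
  have hr : ∀ i u, r i u = b i - A i u := fun i u => rfl
  have hvP : ∀ j, v j ∈ basePolytope M := fun j => by
    rw [hconv]; exact subset_convexHull ℝ _ ⟨j, rfl⟩
  have hvP' : ∀ j, (∀ i, A i (v j) ≤ b i) ∧ ∀ l, C l (v j) = d l := fun j => by
    have := hvP j; rw [hP] at this; exact this
  have hbase : ∀ j, ∃ B, M.IsBase B ∧ v j = charVec M.E B := fun j => by
    have : v j ∈ range v := ⟨j, rfl⟩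
    rwa [hext, extremePoints_basePolytope] at this
  choose β hβ hvβ using hbase
  have hβf : ∀ c (h : S₁ x c.1 = S₂ y c.2) i,
      r i (charVec M.E (β (f.symm ⟨c, h⟩))) = twoProduct S₁ x S₂ y (e i) ⟨c, h⟩ := fun c h i => by
    rw [← hvβ, hr, ← hslack]
    simp
  have hnn : ∀ c (h : S₁ x c.1 = S₂ y c.2) i, 0 ≤ twoProduct S₁ x S₂ y i ⟨c, h⟩ := fun c h i => by
    have h₁ := hslack (e.symm i) (f.symm ⟨c, h⟩)
    simp only [Matrix.submatrix_apply, Equiv.apply_symm_apply] at h₁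
    rw [h₁, sub_nonneg]
    exact (hvP' _).1 _
  refine ⟨{
    row₁ := fun i => if h : i = x then r (e.symm (Sum.inr ()))
      else r (e.symm (Sum.inl (Sum.inl ⟨i, h⟩)))
    row₂ := fun i => if h : i = y then r (e.symm (Sum.inr ()))
      else r (e.symm (Sum.inl (Sum.inr ⟨i, h⟩)))
    n := k
    eqn := fun l => (C l).toAffineMap - AffineMap.const ℝ _ (d l)
    base := fun c c' => if h : S₁ x c = S₂ y c' then β (f.symm ⟨(c, c'), h⟩) else ∅
    row_eq := by simp
    isBase := fun h => by simpa [h] using hβ _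
    surj := fun {B} hB => ?_
    inj := fun {c d c' d'} h h' hcc => ?_
    row₁_base := fun {c d} i h => ?_
    row₂_base := fun {c d} i h => ?_
    eqn_base := fun {c d} l h => ?_
    nonneg₁ := fun {c d} i h => ?_
    nonneg₂ := fun {c d} i h => ?_
    mem := fun {u} h₁ h₂ h₃ => ?_ }⟩
  · have : charVec M.E B ∈ range v := by
      rw [hext, extremePoints_basePolytope]; exact ⟨B, hB, rfl⟩
    obtain ⟨j, hj⟩ := this
    refine ⟨(f j).1.1, (f j).1.2, (f j).2, ?_⟩
    rw [dif_pos (f j).2]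
    have : f.symm ⟨((f j).1.1, (f j).1.2), (f j).2⟩ = j := by simp
    rw [this]
    exact eq_of_charVec_eq (hβ j).subset_ground hB.subset_ground ((hvβ j).symm.trans hj)
  · simp only [h, h', dif_pos] at hcc
    have : v (f.symm ⟨(c, d), h⟩) = v (f.symm ⟨(c', d'), h'⟩) := by rw [hvβ, hvβ, hcc]
    have := f.symm.injective (hv this)
    simpa using this
  · simp only [h, dif_pos]
    split_ifs with hi
    · rw [hβf (c, d) h]
      subst hi
      simp [twoProduct]
    · rw [hβf (c, d) h]
      simp [twoProduct]
  · simp only [h, dif_pos]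
    split_ifs with hi
    · rw [hβf (c, d) h]
      subst hi
      simpa [twoProduct] using h
    · rw [hβf (c, d) h]
      simp [twoProduct]
  · simp only [h, dif_pos]
    rw [← hvβ]
    simp [(hvP' _).2 l]
  · by_cases hi : i = x
    · subst hi
      exact hnn (c, d) h (Sum.inr ())
    · exact hnn (c, d) h (Sum.inl (Sum.inl ⟨i, hi⟩))
  · by_cases hi : i = y
    · subst hi
      rw [← h]
      exact hnn (c, d) h (Sum.inr ())
    · exact hnn (c, d) h (Sum.inl (Sum.inr ⟨i, hi⟩))
  · rw [hP]
    refine ⟨fun i => ?_, fun l => ?_⟩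
    · rw [← sub_nonneg, ← hr]
      obtain ⟨i, rfl⟩ := e.symm.surjective i
      rcases i with (⟨i, hi⟩ | ⟨i, hi⟩) | _
      · simpa [hi] using h₁ i
      · simpa [hi] using h₂ i
      · simpa using h₁ x
    · have := h₃ l
      simp only [AffineMap.coe_sub, Pi.sub_apply, LinearMap.coe_toAffineMap,
        AffineMap.const_apply] at this
      linarith

namespace Glued

variable {M : Matroid α} {S₁ : Matrix ι₁ κ₁ ℝ} {x : ι₁} {S₂ : Matrix ι₂ κ₂ ℝ} {y : ι₂}

/-- Exchange the two factors. -/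
def swap (G : Glued M S₁ x S₂ y) : Glued M S₂ y S₁ x where
  row₁ := G.row₂
  row₂ := G.row₁
  n := G.n
  eqn := G.eqn
  base := fun c d => G.base d c
  row_eq := G.row_eq.symm
  isBase := fun h => G.isBase h.symm
  surj := fun hB => by
    obtain ⟨c, d, h, rfl⟩ := G.surj hB
    exact ⟨d, c, h.symm, rfl⟩
  inj := fun h h' hb => (G.inj h.symm h'.symm hb).symm
  row₁_base := fun i h => G.row₂_base i h.symm
  row₂_base := fun i h => G.row₁_base i h.symm
  eqn_base := fun l h => G.eqn_base l h.symm
  nonneg₁ := fun i h => G.nonneg₂ i h.symm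
  nonneg₂ := fun i h => G.nonneg₁ i h.symm
  mem := fun h₁ h₂ h₃ => G.mem h₂ h₁ h₃

@[simp] theorem swap_base (G : Glued M S₁ x S₂ y) (c : κ₁) (d : κ₂) :
    G.swap.base d c = G.base c d := rfl

/-- If the bases of `N` correspond to the columns of `S₁`, and if the base polytope of `N` is an
affine retract of that of `M` along this correspondence, then `S₁` with the complement of its
special row is a slack matrix of the base polytope of `N`. -/
theorem isSlackMatrix_addComplRow [Finite ι₂] {β : Type*} {N : Matroid β} [N.Finite]
    (G : Glued M S₁ x S₂ y) (hx : IsSpecialRow S₁ x) {d₀ d₁ : κ₂} (hd₀ : S₂ y d₀ = 0)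
    (hd₁ : S₂ y d₁ = 1) {s : κ₁ → κ₂}
    (hs : ∀ c, S₁ x c = 0 ∧ s c = d₀ ∨ S₁ x c = 1 ∧ s c = d₁) {w : κ₁ → Set β}
    (hw : ∀ D, N.IsBase D ↔ ∃ c, D = w c)
    (φ : (N.E → ℝ) →ᵃ[ℝ] (M.E → ℝ)) (π : (M.E → ℝ) →ᵃ[ℝ] (N.E → ℝ))
    (hφ : ∀ c, φ (charVec N.E (w c)) = charVec M.E (G.base c (s c)))
    (hπ : ∀ c d, S₁ x c = S₂ y d → π (charVec M.E (G.base c d)) = charVec N.E (w c)) :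
    IsSlackMatrix (addComplRow S₁ x) (basePolytope N) := by
  have : Finite N.E := N.ground_finite
  have hval : ∀ c, S₁ x c = S₂ y (s c) := fun c => by
    rcases hs c with ⟨h, h'⟩ | ⟨h, h'⟩
    · rw [h, h', hd₀]
    · rw [h, h', hd₁]
  have hset : range (fun c => charVec N.E (w c)) = {z | ∃ B, N.IsBase B ∧ z = charVec N.E B} := by
    ext z
    constructor
    · rintro ⟨c, rfl⟩
      exact ⟨w c, (hw _).2 ⟨c, rfl⟩, rfl⟩
    · rintro ⟨B, hB, rfl⟩
      obtain ⟨c, rfl⟩ := (hw _).1 hB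
      exact ⟨c, rfl⟩
  let ξ : (N.E → ℝ) →ᵃ[ℝ] ℝ := (G.row₁ x).comp φ
  have hξ : ∀ z, ξ z = G.row₁ x (φ z) := fun _ => rfl
  let pr : N.E → (N.E → ℝ) →ᵃ[ℝ] ℝ := fun e => (LinearMap.proj e : (N.E → ℝ) →ₗ[ℝ] ℝ).toAffineMap
  -- The equations force `z = π (φ z)` and make every row of the second factor the interpolation,
  -- with weight `ξ`, between its entries in the columns `d₀` and `d₁`.
  refine isSlackMatrix_of_affineMap (τ := N.E ⊕ Fin G.n ⊕ ι₂)
    (Sum.elim (fun i => (G.row₁ i).comp φ) fun _ => AffineMap.const ℝ _ 1 - ξ)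
    (Sum.elim (fun e => (pr e).comp (π.comp φ) - pr e)
      (Sum.elim (fun l => (G.eqn l).comp φ) fun i =>
        (G.row₂ i).comp φ - (AffineMap.const ℝ _ (S₂ i d₀) + (S₂ i d₁ - S₂ i d₀) • ξ)))
    (fun c => charVec N.E (w c)) ?_ ?_ ?_ ?_ ?_ ?_ ?_
  · intro c c' h
    have : φ (charVec N.E (w c)) = φ (charVec N.E (w c')) := congrArg φ h
    rw [hφ, hφ] at this
    exact (G.inj (hval c) (hval c') (eq_of_charVec_eq (G.isBase (hval c)).subset_ground
      (G.isBase (hval c')).subset_ground this)).1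
  · rw [hset, extremePoints_basePolytope]
  · rw [hset]; rfl
  · intro z hz hz'
    have hx₀ : 0 ≤ G.row₁ x (φ z) := hz (Sum.inl x)
    -- The appended row bounds the weight by 1, which keeps the interpolated rows of the second
    -- factor nonnegative.
    have hx₁ : 0 ≤ 1 - G.row₁ x (φ z) := hz (Sum.inr ())
    have hmem : φ z ∈ basePolytope M := by
      refine G.mem (fun i => hz (Sum.inl i)) (fun i => ?_) fun l => hz' (Sum.inr (Sum.inl l))
      have h : G.row₂ i (φ z) - (S₂ i d₀ + (S₂ i d₁ - S₂ i d₀) * G.row₁ x (φ z)) = 0 :=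
        hz' (Sum.inr (Sum.inr i))
      obtain ⟨-, ⟨c₀, hc₀⟩, c₁, hc₁⟩ := hx
      have h₀ := G.nonneg₂ i (hc₀.trans hd₀.symm)
      have h₁ := G.nonneg₂ i (hc₁.trans hd₁.symm)
      nlinarith [mul_nonneg h₀ hx₁, mul_nonneg h₁ hx₀]
    have hpi : π (φ z) = z := by
      funext e
      have h : π (φ z) e - z e = 0 := hz' (Sum.inl e)
      linarith
    rw [← hpi]
    have : π '' basePolytope M ⊆ basePolytope N := by
      rw [basePolytope, AffineMap.image_convexHull]
      refine convexHull_mono ?_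
      rintro _ ⟨_, ⟨B, hB, rfl⟩, rfl⟩
      obtain ⟨c, d, h, rfl⟩ := G.surj hB
      exact ⟨w c, (hw _).2 ⟨c, rfl⟩, hπ c d h⟩
    exact this ⟨_, hmem, rfl⟩
  · rintro (e | l | i) c
    · change π (φ (charVec N.E (w c))) e - charVec N.E (w c) e = 0
      rw [hφ, hπ c _ (hval c), sub_self]
    · change G.eqn l (φ (charVec N.E (w c))) = 0
      rw [hφ, G.eqn_base l (hval c)]
    · change G.row₂ i (φ (charVec N.E (w c))) -
        (S₂ i d₀ + (S₂ i d₁ - S₂ i d₀) * G.row₁ x (φ (charVec N.E (w c)))) = 0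
      rw [hφ, G.row₂_base i (hval c), G.row₁_base x (hval c)]
      rcases hs c with ⟨h, h'⟩ | ⟨h, h'⟩ <;> rw [h, h'] <;> ring
  · rintro (i | _) c
    · change S₁ i c = G.row₁ i (φ (charVec N.E (w c)))
      rw [hφ, G.row₁_base i (hval c)]
    · change 1 - S₁ x c = 1 - G.row₁ x (φ (charVec N.E (w c)))
      rw [hφ, G.row₁_base x (hval c)]
  · rintro (i | _) c
    · exact G.nonneg₁ i (hval c)
    · change 0 ≤ 1 - S₁ x c
      rcases hs c with ⟨h, -⟩ | ⟨h, -⟩ <;> rw [h] <;> norm_num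

end Glued

theorem IsTwoSum.symm {β : Type*} {N M₁ M₂ : Matroid β} {p : β} (h : IsTwoSum N M₁ M₂ p) :
    IsTwoSum N M₂ M₁ p := by
  obtain ⟨h₁, h₂, h₃, h₄, h₅, h₆, h₇⟩ := h
  refine ⟨by rw [inter_comm, h₁], h₄, h₅, h₂, h₃, by rw [h₆, union_comm], fun B => ?_⟩
  rw [h₇]
  constructor <;> rintro ⟨B₁, B₂, hB₁, hB₂, hp, rfl⟩ <;>
    exact ⟨B₂, B₁, hB₂, hB₁, by rwa [symmDiff_comm], by rw [union_comm]⟩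

/-! ### Slack matrices of the summands -/

namespace Glued

variable {M : Matroid α} {S₁ : Matrix ι₁ κ₁ ℝ} {x : ι₁} {S₂ : Matrix ι₂ κ₂ ℝ} {y : ι₂}

theorem row₁_special_eq (G : Glued M S₁ x S₂ y) (hx : IsSpecialRow S₁ x) {B : Set α}
    (hB : M.IsBase B) : G.row₁ x (charVec M.E B) = 0 ∨ G.row₁ x (charVec M.E B) = 1 := by
  obtain ⟨c, d, h, rfl⟩ := G.surj hB
  rw [G.row₁_base x h]
  exact hx.1 c

/-- The map `φ` keeps the coordinates in `A` and fills in the others by interpolating between `B₀`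
and `B₁` with the coordinate `none` as weight; `π` forgets the coordinates outside `A` and recovers
`none` by `ξ`. -/
theorem isSlackMatrix_half [M.Finite] [Finite ι₂] (G : Glued M S₁ x S₂ y)
    (hx : IsSpecialRow S₁ x) {d₀ d₁ : κ₂} (hd₀ : S₂ y d₀ = 0)
    (hd₁ : S₂ y d₁ = 1) {s : κ₁ → κ₂}
    (hs : ∀ c, S₁ x c = 0 ∧ s c = d₀ ∨ S₁ x c = 1 ∧ s c = d₁)
    {τ : Set α → Prop} {A B₀ B₁ : Set α} {N : Matroid (Option α)} (hA : A ⊆ M.E)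
    (hE : N.E = insert none (some '' A))
    (hN : ∀ D, N.IsBase D ↔ ∃ B, M.IsBase B ∧ D = halfSet τ A B)
    (ξ : (M.E → ℝ) →ᵃ[ℝ] ℝ)
    (hξ₁ : ∀ B, M.IsBase B → τ B → ξ (charVec M.E B) = 1)
    (hξ₀ : ∀ B, M.IsBase B → ¬ τ B → ξ (charVec M.E B) = 0)
    (hdep : ∀ c d, S₁ x c = S₂ y d →
      halfSet τ A (G.base c d) = halfSet τ A (G.base c (s c)))
    (hout₁ : ∀ c, τ (G.base c (s c)) → ∀ e ∈ M.E, e ∉ A → (e ∈ G.base c (s c) ↔ e ∈ B₁))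
    (hout₀ : ∀ c, ¬ τ (G.base c (s c)) → ∀ e ∈ M.E, e ∉ A → (e ∈ G.base c (s c) ↔ e ∈ B₀)) :
    IsSlackMatrix (addComplRow S₁ x) (basePolytope N) := by
  classical
  have : N.Finite := ⟨by
    rw [hE]
    exact ((M.ground_finite.subset hA).image _).insert _⟩
  have hnone : none ∈ N.E := by simp [hE]
  have hsome : ∀ {e}, e ∈ A → some e ∈ N.E := fun h => by simp [hE, h]
  have hval : ∀ c, S₁ x c = S₂ y (s c) := fun c => by
    rcases hs c with ⟨h, h'⟩ | ⟨h, h'⟩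
    · rw [h, h', hd₀]
    · rw [h, h', hd₁]
  let pr : N.E → (N.E → ℝ) →ᵃ[ℝ] ℝ := fun e => (LinearMap.proj e : (N.E → ℝ) →ₗ[ℝ] ℝ).toAffineMap
  have hpr : ∀ e z, pr e z = z e := fun _ _ => rfl
  let φ : (N.E → ℝ) →ᵃ[ℝ] (M.E → ℝ) := AffineMap.pi fun e : M.E =>
    if h : (e : α) ∈ A then pr ⟨some e, hsome h⟩
    else AffineMap.const ℝ _ (charVec M.E B₀ e) +
      (charVec M.E B₁ e - charVec M.E B₀ e) • pr ⟨none, hnone⟩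
  let π : (M.E → ℝ) →ᵃ[ℝ] (N.E → ℝ) := AffineMap.pi fun o : N.E =>
    if h : ∃ e : M.E, (o : Option α) = some (e : α) then
      (LinearMap.proj h.choose : (M.E → ℝ) →ₗ[ℝ] ℝ).toAffineMap
    else ξ
  have hπsome : ∀ u (e : M.E) (h : some (e : α) ∈ N.E), π u ⟨some (e : α), h⟩ = u e := by
    intro u e h
    have h' : ∃ e' : M.E, some (e : α) = some (e' : α) := ⟨e, rfl⟩
    have h'' : h'.choose = e := Subtype.ext (Option.some.inj h'.choose_spec).symm
    simp only [π, AffineMap.pi_apply]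
    rw [dif_pos h']
    change u h'.choose = u e
    rw [h'']
  have hπnone : ∀ u, π u ⟨none, hnone⟩ = ξ u := by
    intro u
    simp [π]
  refine G.isSlackMatrix_addComplRow hx hd₀ hd₁ hs (w := fun c => halfSet τ A (G.base c (s c)))
    (fun D => ?_) φ π (fun c => ?_) (fun c d h => ?_)
  · rw [hN]
    constructor
    · rintro ⟨B, hB, rfl⟩
      obtain ⟨c, d, h, rfl⟩ := G.surj hB
      exact ⟨c, hdep c d h⟩
    · rintro ⟨c, rfl⟩
      exact ⟨_, G.isBase (hval c), rfl⟩
  · funext e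
    simp only [φ, AffineMap.pi_apply]
    split_ifs with h
    · rw [hpr]
      exact charVec_congr (by simp [h])
    · simp only [AffineMap.coe_add, AffineMap.coe_smul, Pi.add_apply, Pi.smul_apply,
        AffineMap.const_apply, hpr, smul_eq_mul]
      by_cases hτ : τ (G.base c (s c))
      · rw [charVec_of_mem (e := (⟨none, hnone⟩ : N.E)) (by simpa using hτ),
          charVec_congr (hout₁ c hτ e e.2 h)]
        ring
      · rw [charVec_of_notMem (e := (⟨none, hnone⟩ : N.E)) (by simpa using hτ),
          charVec_congr (hout₀ c hτ e e.2 h)]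
        ring
  · rw [← hdep c d h]
    funext ⟨o, ho⟩
    cases o with
    | none =>
      rw [hπnone]
      by_cases hτ : τ (G.base c d)
      · rw [hξ₁ _ (G.isBase h) hτ, charVec_of_mem (by simpa using hτ)]
      · rw [hξ₀ _ (G.isBase h) hτ, charVec_of_notMem (by simpa using hτ)]
    | some e =>
      have heA : e ∈ A := by simpa [hE] using ho
      rw [hπsome _ ⟨e, hA heA⟩]
      exact charVec_congr (by simp [heA])

/-- The type is a value `ε` of the special row, so the new coordinate is `x` or `𝟏 - x`. -/
theorem isSlackMatrix_of_split [M.Finite] [Finite ι₂] (G : Glued M S₁ x S₂ y)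
    (hx : IsSpecialRow S₁ x) {τ : Set α → Prop} {ε : ℝ} (hε : ε = 0 ∨ ε = 1)
    (hτ : ∀ B, M.IsBase B → (τ B ↔ G.row₁ x (charVec M.E B) = ε)) {A B B' : Set α}
    {N : Matroid (Option α)} (hA : A ⊆ M.E) (hB : M.IsBase B) (hB' : M.IsBase B') (hτB : τ B)
    (hτB' : ¬ τ B')
    (hin : ∀ c d d', S₁ x c = S₂ y d → S₁ x c = S₂ y d' → ∀ e ∈ A,
      (e ∈ G.base c d ↔ e ∈ G.base c d'))
    (hout : ∀ c c' d, S₁ x c = S₂ y d → S₁ x c' = S₂ y d → ∀ e ∈ M.E, e ∉ A →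
      (e ∈ G.base c d ↔ e ∈ G.base c' d))
    (hE : N.E = insert none (some '' A))
    (hN : ∀ D, N.IsBase D ↔ ∃ B, M.IsBase B ∧ D = halfSet τ A B) :
    IsSlackMatrix (addComplRow S₁ x) (basePolytope N) := by
  classical
  have hval := fun {D} (hD : M.IsBase D) => G.row₁_special_eq hx hD
  have hτc : ∀ {c d}, S₁ x c = S₂ y d → (τ (G.base c d) ↔ S₁ x c = ε) := fun {c d} h => by
    rw [hτ _ (G.isBase h), G.row₁_base x h]
  obtain ⟨cB, dB, hcd, rfl⟩ := G.surj hB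
  obtain ⟨cB', dB', hcd', rfl⟩ := G.surj hB'
  have hdB : S₂ y dB = ε := hcd.symm.trans ((hτc hcd).1 hτB)
  have hdB' : S₂ y dB' ≠ ε := fun h => hτB' ((hτc hcd').2 (hcd'.trans h))
  have hdep : ∀ s : κ₁ → κ₂, (∀ c, S₁ x c = S₂ y (s c)) → ∀ c d, S₁ x c = S₂ y d →
      halfSet τ A (G.base c d) = halfSet τ A (G.base c (s c)) := by
    intro s hs c d h
    ext o
    cases o with
    | none => simp only [none_mem_halfSet, hτc h, hτc (hs c)]
    | some e =>
      simp only [some_mem_halfSet]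
      exact and_congr_left fun he => hin c d (s c) h (hs c) e he
  have hdB'val : S₂ y dB' = 0 ∨ S₂ y dB' = 1 := hcd' ▸ hx.1 cB'
  let s : κ₁ → κ₂ := fun c => if S₁ x c = ε then dB else dB'
  have hs : ∀ c, S₁ x c = S₂ y (s c) := fun c => by
    simp only [s]
    split_ifs with h
    · rw [h, hdB]
    · have := hx.1 c
      grind
  have hout₁ : ∀ c, τ (G.base c (s c)) → ∀ e ∈ M.E, e ∉ A →
      (e ∈ G.base c (s c) ↔ e ∈ G.base cB dB) := by
    intro c hc e he heA
    have : s c = dB := if_pos ((hτc (hs c)).1 hc)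
    have h := hs c
    rw [this] at h ⊢
    exact hout c cB dB h hcd e he heA
  have hout₀ : ∀ c, ¬ τ (G.base c (s c)) → ∀ e ∈ M.E, e ∉ A →
      (e ∈ G.base c (s c) ↔ e ∈ G.base cB' dB') := by
    intro c hc e he heA
    have : s c = dB' := if_neg fun h => hc ((hτc (hs c)).2 h)
    have h := hs c
    rw [this] at h ⊢
    exact hout c cB' dB' h hcd' e he heA
  rcases hε with rfl | rfl
  · refine G.isSlackMatrix_half hx (d₀ := dB) (d₁ := dB') hdB (by tauto) (s := s) ?_ hA hE hN
      (AffineMap.const ℝ _ 1 - G.row₁ x) ?_ ?_ (hdep s hs) hout₁ hout₀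
    · intro c
      have := hx.1 c
      simp only [s]
      grind
    · intro D hD hτD
      simp [(hτ D hD).1 hτD]
    · intro D hD hτD
      have := (hval hD).resolve_left fun h => hτD ((hτ D hD).2 h)
      simp [this]
  · refine G.isSlackMatrix_half hx (d₀ := dB') (d₁ := dB) (by tauto) hdB (s := s) ?_ hA hE hN
      (G.row₁ x) ?_ ?_ (hdep s hs) hout₁ hout₀
    · intro c
      have := hx.1 c
      simp only [s]
      grind
    · intro D hD hτD
      exact (hτ D hD).1 hτD
    · intro D hD hτD
      exact (hval hD).resolve_right fun h => hτD ((hτ D hD).2 h)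

theorem exists_twoSum_of_split [M.Finite] [Finite ι₁] [Finite ι₂] (G : Glued M S₁ x S₂ y)
    (hx : IsSpecialRow S₁ x) (hy : IsSpecialRow S₂ y) {A B : Set α} {i j : α} (hA : A ⊆ M.E)
    (hB : M.IsBase B) (hB' : M.IsBase (insert j (B \ {i}))) (hi : i ∈ B)
    (hj : j ∉ B) (hiA : i ∉ A) (hjA : j ∈ A)
    (hne : G.row₁ x (charVec M.E B) ≠ G.row₁ x (charVec M.E (insert j (B \ {i}))))
    (hin : ∀ c d d', S₁ x c = S₂ y d → S₁ x c = S₂ y d' → ∀ e ∈ A,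
      (e ∈ G.base c d ↔ e ∈ G.base c d'))
    (hout : ∀ c c' d, S₁ x c = S₂ y d → S₁ x c' = S₂ y d → ∀ e ∈ M.E, e ∉ A →
      (e ∈ G.base c d ↔ e ∈ G.base c' d)) :
    ∃ M₁ M₂ : Matroid (Option α),
      IsTwoSum (M.mapEmbedding Function.Embedding.some) M₁ M₂ none ∧
      IsSlackMatrix (addComplRow S₁ x) (basePolytope M₁) ∧
      IsSlackMatrix (addComplRow S₂ y) (basePolytope M₂) := by
  have hval := fun {D} (hD : M.IsBase D) => G.row₁_special_eq hx hD
  set ε := G.row₁ x (charVec M.E B) with hε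
  let τ : Set α → Prop := fun D => G.row₁ x (charVec M.E D) = ε
  have hmix : Mixes M τ A := by
    intro D D' hD hD' hDD
    obtain ⟨c, d, h, rfl⟩ := G.surj hD
    obtain ⟨c', d', h', rfl⟩ := G.surj hD'
    have hv₁ := hval hD
    have hv₂ := hval hD'
    have hv₃ := hval hB
    have hcc : S₁ x c = S₁ x c' := by
      simp only [τ] at hDD
      rw [← hε] at hv₃
      rw [G.row₁_base x h] at hDD hv₁
      rw [G.row₁_base x h'] at hDD hv₂
      grind
    have h'' : S₁ x c = S₂ y d' := hcc.trans h'
    -- Gluing bases crosswise amounts to recombining their columns.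
    have heq : G.base c d ∩ A ∪ G.base c' d' \ A = G.base c d' := by
      ext e
      by_cases heA : e ∈ A
      · simp [heA, hin c d d' h h'' e heA]
      · simp only [mem_union, mem_inter_iff, heA, and_false, mem_sdiff, not_false_eq_true,
          and_true, false_or]
        by_cases he : e ∈ M.E
        · exact hout c' c d' h' h'' e he heA
        · exact ⟨fun h₁ => absurd (hD'.subset_ground h₁) he,
            fun h₁ => absurd ((G.isBase h'').subset_ground h₁) he⟩
    rw [heq]
    refine ⟨G.isBase h'', ?_⟩
    simp only [τ]
    rw [G.row₁_base x h, G.row₁_base x h'']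
  obtain ⟨M₁, M₂, hsum, hE₁, hE₂, hM₁, hM₂⟩ :=
    exists_twoSum (τ := τ) hA hmix hB hB' hi hj hiA hjA rfl (Ne.symm hne)
  refine ⟨M₁, M₂, hsum, ?_, ?_⟩
  · exact G.isSlackMatrix_of_split hx (hval hB) (fun _ _ => Iff.rfl) hA hB hB' rfl (Ne.symm hne)
      hin hout hE₁ hM₁
  · refine G.swap.isSlackMatrix_of_split (τ := fun D => ¬ τ D) (ε := 1 - ε) hy
      (by have := hval hB; grind) ?_ (A := M.E \ A) sdiff_subset hB' hB (Ne.symm hne)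
      (by simp [τ, hε])
      ?_ ?_ hE₂ hM₂
    · intro D hD
      change ¬ (G.row₁ x (charVec M.E D) = ε) ↔ G.row₂ y (charVec M.E D) = 1 - ε
      rw [← G.row_eq]
      have := hval hD
      have := hval hB
      grind
    · intro d c c' h h' e he
      exact hout c c' d h.symm h'.symm e he.1 he.2
    · intro d d' c h h' e he heA
      exact hin c d d' h.symm h'.symm e (by simpa [he] using heA)

/-- The second factor carries only the special entry. The first summand is `M` with `i` renamed to
`none`, the second has the two bases `{none}` and `{some i}`. -/
theorem exists_twoSum_of_two_columns [M.Finite] [Finite ι₁] [Finite ι₂] (G : Glued M S₁ x S₂ y)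
    (hx : IsSpecialRow S₁ x) (hy : IsSpecialRow S₂ y) {B : Set α} {i j : α}
    (hB : M.IsBase B) (hB' : M.IsBase (insert j (B \ {i}))) (hi : i ∈ B) (hj : j ∉ B)
    (htwo : ∀ d d', S₂ y d = S₂ y d' → d = d') :
    ∃ M₁ M₂ : Matroid (Option α),
      IsTwoSum (M.mapEmbedding Function.Embedding.some) M₁ M₂ none ∧
      IsSlackMatrix (addComplRow S₁ x) (basePolytope M₁) ∧
      IsSlackMatrix (addComplRow S₂ y) (basePolytope M₂) := by
  classical
  have hij : i ≠ j := fun h => hj (h ▸ hi)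
  have hiE : i ∈ M.E := hB.subset_ground hi
  have hjE : j ∈ M.E := hB'.subset_ground (mem_insert _ _)
  have hA : M.E \ {i} ⊆ M.E := sdiff_subset
  have hmix : Mixes M (fun D => i ∈ D) (M.E \ {i}) := by
    intro D D' hD hD' hDD
    have : D ∩ (M.E \ {i}) ∪ D' \ (M.E \ {i}) = D := by
      have h₁ := hD.subset_ground
      have h₂ := hD'.subset_ground
      ext e
      simp only [mem_union, mem_inter_iff, mem_sdiff, mem_singleton_iff]
      grind
    rw [this]
    exact ⟨hD, Iff.rfl⟩
  have hiB' : i ∉ insert j (B \ {i}) := by simp [hij]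
  obtain ⟨M₁, M₂, hsum, hE₁, hE₂, hM₁, hM₂⟩ :=
    exists_twoSum (τ := fun D => i ∈ D) hA hmix hB hB' hi hj (by simp)
      ⟨hjE, by simpa using hij.symm⟩ hi hiB'
  obtain ⟨d₀, hd₀⟩ := hy.2.1
  obtain ⟨d₁, hd₁⟩ := hy.2.2
  obtain ⟨c₀, hc₀⟩ := hx.2.1
  obtain ⟨c₁, hc₁⟩ := hx.2.2
  refine ⟨M₁, M₂, hsum, ?_, ?_⟩
  · let s : κ₁ → κ₂ := fun c => if S₁ x c = 1 then d₁ else d₀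
    have hs : ∀ c, S₁ x c = 0 ∧ s c = d₀ ∨ S₁ x c = 1 ∧ s c = d₁ := fun c => by
      have := hx.1 c
      simp only [s]
      grind
    refine G.isSlackMatrix_half hx hd₀ hd₁ hs (B₀ := insert j (B \ {i})) (B₁ := B) hA hE₁ hM₁
      (LinearMap.proj ⟨i, hiE⟩ : (M.E → ℝ) →ₗ[ℝ] ℝ).toAffineMap ?_ ?_ ?_ ?_ ?_
    · exact fun D _ hD => charVec_of_mem (e := (⟨i, hiE⟩ : M.E)) hD
    · exact fun D _ hD => charVec_of_notMem (e := (⟨i, hiE⟩ : M.E)) hD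
    · intro c d h
      have : d = s c := htwo _ _ (by
        rcases hs c with h' | h'
        · rw [h'.2, ← h, h'.1, hd₀]
        · rw [h'.2, ← h, h'.1, hd₁])
      rw [this]
    · intro c hc e he heA
      obtain rfl : e = i := by simpa [he] using heA
      simp [hc, hi]
    · intro c hc e he heA
      obtain rfl : e = i := by simpa [he] using heA
      simp [hc, hij]
  · have hAi : M.E \ (M.E \ {i}) = {i} := by ext e; simp; grind
    rw [hAi] at hE₂ hM₂
    have : M₂.Finite := ⟨by rw [hE₂]; simp⟩
    have hnone : none ∈ M₂.E := by simp [hE₂]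
    have hsome : some i ∈ M₂.E := by simp [hE₂]
    let s : κ₂ → κ₁ := fun d => if S₂ y d = 1 then c₁ else c₀
    have hs : ∀ d, S₂ y d = 0 ∧ s d = c₀ ∨ S₂ y d = 1 ∧ s d = c₁ := fun d => by
      have := hy.1 d
      simp only [s]
      grind
    -- The special row need not be the coordinate of `i`, so the two bases are matched to columns by
    -- special entry instead of membership of `i`.
    let w : κ₂ → Set (Option α) := fun d => if S₂ y d = 1 then {some i} else {none}
    let pr : M₂.E → (M₂.E → ℝ) →ₗ[ℝ] ℝ := fun e => LinearMap.proj e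
    let φ : (M₂.E → ℝ) →ᵃ[ℝ] (M.E → ℝ) :=
      ((pr ⟨some i, hsome⟩).smulRight (charVec M.E (G.base c₁ d₁)) +
        (pr ⟨none, hnone⟩).smulRight (charVec M.E (G.base c₀ d₀))).toAffineMap
    have hφ : ∀ z, φ z = z ⟨some i, hsome⟩ • charVec M.E (G.base c₁ d₁) +
        z ⟨none, hnone⟩ • charVec M.E (G.base c₀ d₀) := fun _ => rfl
    let π : (M.E → ℝ) →ᵃ[ℝ] (M₂.E → ℝ) := AffineMap.pi fun o : M₂.E =>
      if (o : Option α) = none then AffineMap.const ℝ _ 1 - G.row₁ x else G.row₁ x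
    have hw : ∀ D, M₂.IsBase D ↔ ∃ d, D = w d := by
      have h₀ : ∀ D : Set α, i ∉ D → halfSet (fun D : Set α => i ∉ D) {i} D = {none} := by
        intro D hD
        ext o; cases o <;> simp [hD]; grind
      have h₁ : ∀ D : Set α, i ∈ D → halfSet (fun D : Set α => i ∉ D) {i} D = {some i} := by
        intro D hD
        ext o; cases o <;> simp [hD]; grind
      intro D
      rw [hM₂]
      constructor
      · rintro ⟨D, hD, rfl⟩
        by_cases hiD : i ∈ D
        · exact ⟨d₁, by simp [w, hd₁, h₁ D hiD]⟩
        · exact ⟨d₀, by simp [w, hd₀, h₀ D hiD]⟩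
      · rintro ⟨d, rfl⟩
        by_cases hd : S₂ y d = 1
        · exact ⟨B, hB, by simp [w, hd, h₁ B hi]⟩
        · exact ⟨_, hB', by simp only [w, hd, if_false]; rw [h₀ _ hiB']⟩
    refine G.swap.isSlackMatrix_addComplRow hy hc₀ hc₁ hs hw φ π ?_ ?_
    · intro d
      rw [hφ]
      rcases hs d with ⟨h, h'⟩ | ⟨h, h'⟩
      · rw [h', htwo d d₀ (h.trans hd₀.symm)]
        simp [w, hd₀, charVec]
      · rw [h', htwo d d₁ (h.trans hd₁.symm)]
        simp [w, hd₁, charVec]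
    · intro d c h
      have hrow := G.row₁_base x h.symm
      rw [swap_base]
      funext ⟨o, ho⟩
      simp only [π, AffineMap.pi_apply]
      have ho' : o = none ∨ o = some i := by simpa [hE₂] using ho
      rcases hs d with ⟨h', -⟩ | ⟨h', -⟩ <;> rcases ho' with rfl | rfl <;>
        simp [hrow, ← h, h', w, charVec]

end Glued
-- Equivalence relations and differences of unit vectors
/-- If two equivalence relations together relate all pairs, then one of them does so already. -/
theorem forall_or_forall_of_equivalence {E : Type*} {r₁ r₂ : E → E → Prop} (h₁ : Equivalence r₁)
    (h₂ : Equivalence r₂) (h : ∀ i j, r₁ i j ∨ r₂ i j) : (∀ i j, r₁ i j) ∨ ∀ i j, r₂ i j := by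
  by_contra! hcon
  obtain ⟨⟨i, j, hij⟩, k, l, hkl⟩ := hcon
  have s₁ := @h₁.symm
  have s₂ := @h₂.symm
  have t₁ := @h₁.trans
  have t₂ := @h₂.trans
  have hij' := (h i j).resolve_left hij
  have hkl' := (h k l).resolve_right hkl
  rcases h i k with hik | hik
  · have hjk : r₂ j k := (h j k).resolve_left fun hjk => hij (t₁ hik (s₁ hjk))
    have hjl : r₂ j l := (h j l).resolve_left fun hjl => hij (t₁ (t₁ hik hkl') (s₁ hjl))
    exact hkl (t₂ (s₂ hjk) hjl)
  · have hil : r₁ i l := (h i l).resolve_right fun hil => hkl (t₂ (s₂ hik) hil)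
    have hjk : r₂ j k := t₂ (s₂ hij') hik
    have hjl : r₁ j l := (h j l).resolve_right fun hjl => hkl (t₂ (s₂ hjk) hjl)
    exact hij (t₁ hil (s₁ hjl))

section singles

variable {E : Type*} [Fintype E] [DecidableEq E]

theorem mem_of_single_sub_single_mem {K : Submodule ℝ (E → ℝ)} {p : E → Prop}
    (hK : ∀ i j, p i → p j → Pi.single i (1 : ℝ) - Pi.single j 1 ∈ K) {u : E → ℝ}
    (hu : ∀ e, ¬ p e → u e = 0) (hsum : ∑ e, u e = 0) : u ∈ K := by
  by_cases hp : ∃ e, p e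
  · obtain ⟨e₀, he₀⟩ := hp
    have : u = ∑ e, u e • (Pi.single e (1 : ℝ) - Pi.single e₀ 1 : E → ℝ) := by
      simp only [smul_sub, Finset.sum_sub_distrib, ← Finset.sum_smul, hsum, zero_smul, sub_zero]
      funext e
      simp [Finset.sum_apply, Pi.single_apply]
    rw [this]
    refine K.sum_mem fun e _ => ?_
    by_cases he : p e
    · exact K.smul_mem _ (hK e e₀ he he₀)
    · simp [hu e he]
  · have : u = 0 := funext fun e => hu e fun h => hp ⟨e, h⟩
    rw [this]
    exact K.zero_mem

theorem linearMap_apply_eq_sum_single (f : (E → ℝ) →ₗ[ℝ] ℝ) (u : E → ℝ) :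
    f u = ∑ e, u e * f (Pi.single e 1) := by
  conv_lhs => rw [pi_eq_sum_univ' u]
  simp

theorem ite_add_ite_not {E : Type*} (p : E → Prop) [DecidablePred p] (u : E → ℝ) :
    (fun e => if p e then u e else 0) + (fun e => if ¬ p e then u e else 0) = u := by
  funext e
  by_cases he : p e <;> simp [he]

end singles

section bases

variable {M : Matroid α}

theorem sum_charVec_sub_eq_zero [Fintype M.E] {B B' : Set α} (hB : M.IsBase B)
    (hB' : M.IsBase B') : ∑ e, (charVec M.E B - charVec M.E B') e = 0 := by
  classical
  have key : ∀ {D : Set α}, D ⊆ M.E → ∑ e, charVec M.E D e = D.ncard := by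
    intro D hD
    have h₁ : ∀ e : M.E, charVec M.E D e = if (e : α) ∈ D then 1 else 0 := fun e => by
      by_cases h : (e : α) ∈ D <;> simp [charVec, h]
    simp only [h₁, Finset.sum_boole]
    congr 1
    rw [← Set.ncard_coe_finset, ← Set.ncard_image_of_injective _ Subtype.val_injective]
    congr 1
    ext e
    simp only [Finset.coe_filter, Finset.mem_univ, true_and, mem_image, mem_ofPred_eq,
      Subtype.exists, exists_and_left, exists_prop, exists_eq_right_right]
    exact ⟨fun h => h.1, fun h => ⟨h, hD h⟩⟩
  simp only [Pi.sub_apply, Finset.sum_sub_distrib, key hB.subset_ground, key hB'.subset_ground,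
    hB.ncard_eq_ncard_of_isBase hB', sub_self]

theorem charVec_exchange_sub [DecidableEq M.E] {B : Set α} {i j : M.E} (hi : (i : α) ∈ B)
    (hj : (j : α) ∉ B) : charVec M.E (insert (j : α) (B \ {(i : α)})) - charVec M.E B =
      Pi.single j 1 - Pi.single i 1 := by
  have hij : i ≠ j := fun h => hj (h ▸ hi)
  funext e
  simp only [Pi.sub_apply]
  by_cases hei : e = i
  · subst hei
    rw [charVec_of_mem hi, charVec_of_notMem (by simpa [Subtype.ext_iff] using hij)]
    simp [hij]
  · by_cases hej : e = j
    · subst hej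
      rw [charVec_of_notMem hj, charVec_of_mem (by simp)]
      simp [hei]
    · rw [charVec_congr (e := e) (f := e) (D := B)]
      · simp [hei, hej]
      · have h₁ : (e : α) ≠ i := fun h => hei (Subtype.ext h)
        have h₂ : (e : α) ≠ j := fun h => hej (Subtype.ext h)
        simp [h₁, h₂]

end bases

/-! ### Direction spaces and the two classes of elements -/

namespace Glued

variable {M : Matroid α} {S₁ : Matrix ι₁ κ₁ ℝ} {x : ι₁} {S₂ : Matrix ι₂ κ₂ ℝ} {y : ι₂}

/-- The directions in which the equations and the rows of the second factor are constant. -/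
def dir₁ (G : Glued M S₁ x S₂ y) : Submodule ℝ (M.E → ℝ) :=
  (⨅ i, LinearMap.ker (G.row₂ i).linear) ⊓ ⨅ l, LinearMap.ker (G.eqn l).linear

/-- The directions in which the equations and the rows of the first factor are constant. -/
def dir₂ (G : Glued M S₁ x S₂ y) : Submodule ℝ (M.E → ℝ) := G.swap.dir₁

theorem mem_dir₁ {G : Glued M S₁ x S₂ y} {u : M.E → ℝ} :
    u ∈ G.dir₁ ↔ (∀ i, (G.row₂ i).linear u = 0) ∧ ∀ l, (G.eqn l).linear u = 0 := by
  simp [dir₁]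

theorem mem_dir₂ {G : Glued M S₁ x S₂ y} {u : M.E → ℝ} :
    u ∈ G.dir₂ ↔ (∀ i, (G.row₁ i).linear u = 0) ∧ ∀ l, (G.eqn l).linear u = 0 :=
  mem_dir₁ (G := G.swap)

theorem linear_sub (f : (M.E → ℝ) →ᵃ[ℝ] ℝ) (u v : M.E → ℝ) :
    f.linear (u - v) = f u - f v := f.linearMap_vsub u v

theorem sub_mem_dir₁ (G : Glued M S₁ x S₂ y) {c c' : κ₁} {d : κ₂} (h : S₁ x c = S₂ y d)
    (h' : S₁ x c' = S₂ y d) :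
    charVec M.E (G.base c d) - charVec M.E (G.base c' d) ∈ G.dir₁ := by
  rw [mem_dir₁]
  refine ⟨fun i => ?_, fun l => ?_⟩
  · rw [linear_sub, G.row₂_base i h, G.row₂_base i h', sub_self]
  · rw [linear_sub, G.eqn_base l h, G.eqn_base l h', sub_self]

theorem sub_mem_dir₂ (G : Glued M S₁ x S₂ y) {c : κ₁} {d d' : κ₂} (h : S₁ x c = S₂ y d)
    (hd : S₁ x c = S₂ y d') :
    charVec M.E (G.base c d) - charVec M.E (G.base c d') ∈ G.dir₂ :=
  G.swap.sub_mem_dir₁ h.symm hd.symm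

/-- A polytope contains no line. -/
theorem eq_zero_of_mem_dir (G : Glued M S₁ x S₂ y) {u : M.E → ℝ} (h₁ : u ∈ G.dir₁)
    (h₂ : u ∈ G.dir₂) : u = 0 := by
  rw [mem_dir₁] at h₁
  rw [mem_dir₂] at h₂
  obtain ⟨B, hB⟩ := M.exists_isBase
  obtain ⟨c, d, h, rfl⟩ := G.surj hB
  have happ : ∀ (f : (M.E → ℝ) →ᵃ[ℝ] ℝ) (t : ℝ), f.linear u = 0 →
      f (t • u + charVec M.E (G.base c d)) = f (charVec M.E (G.base c d)) := fun f t hf => by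
    have := f.map_vadd (charVec M.E (G.base c d)) (t • u)
    simpa [hf] using this
  have hmem : ∀ t : ℝ, t • u + charVec M.E (G.base c d) ∈ basePolytope M := fun t => by
    refine G.mem (fun i => ?_) (fun i => ?_) fun l => ?_
    · rw [happ _ _ (h₂.1 i), G.row₁_base i h]
      exact G.nonneg₁ i h
    · rw [happ _ _ (h₁.1 i), G.row₂_base i h]
      exact G.nonneg₂ i h
    · rw [happ _ _ (h₁.2 l), G.eqn_base l h]
  funext e
  by_contra hne
  have hne' : u e ≠ 0 := hne
  -- The factor `2 / u e` moves coordinate `e` by 2, out of the interval from 0 to 1.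
  have h₃ := basePolytope_subset_cube M (hmem (2 / u e)) e trivial
  have h₄ := basePolytope_subset_cube M (charVec_mem_basePolytope hB) e trivial
  have h₅ : (2 / u e) * u e = 2 := by field_simp
  simp only [Pi.add_apply, Pi.smul_apply, smul_eq_mul, h₅, mem_Icc] at h₃
  linarith [h₃.2, h₄.1]

/-- An exchange that preserves the special entry moves only one component of the column. -/
theorem exchange_mem_dir [DecidableEq M.E] (G : Glued M S₁ x S₂ y) {B : Set α} {i j : M.E}
    (hB : M.IsBase B) (hi : (i : α) ∈ B) (hj : (j : α) ∉ B)
    (hB' : M.IsBase (insert (j : α) (B \ {(i : α)})))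
    (hij : (G.row₁ x).linear (Pi.single j 1 - Pi.single i 1) = 0) :
    (Pi.single j 1 - Pi.single i 1 : M.E → ℝ) ∈ G.dir₁ ∨
      (Pi.single j 1 - Pi.single i 1 : M.E → ℝ) ∈ G.dir₂ := by
  rw [← charVec_exchange_sub hi hj] at hij ⊢
  rw [linear_sub] at hij
  set B' := insert (j : α) (B \ {(i : α)}) with hB'def
  have hiB' : (i : α) ∉ B' := by
    have : (i : α) ≠ j := fun h => hj (h ▸ hi)
    simp [hB'def, this]
  have hBB' : ∀ e ∈ B, e ≠ i → e ∈ B' := fun e he hei => Or.inr ⟨he, hei⟩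
  clear_value B'
  obtain ⟨c, d, h, rfl⟩ := G.surj hB
  obtain ⟨c', d', hcd, rfl⟩ := G.surj hB'
  rw [G.row₁_base x h, G.row₁_base x hcd, sub_eq_zero] at hij
  have h₁ : S₁ x c = S₂ y d' := hij.symm.trans hcd
  have h₂ : S₁ x c' = S₂ y d := hij.trans h
  -- Grouped one way, the alternating sum of the four bases lies in `dir₂`; grouped the other way,
  -- in `dir₁`.
  have hzero : (charVec M.E (G.base c d) - charVec M.E (G.base c d')) -
      (charVec M.E (G.base c' d) - charVec M.E (G.base c' d')) = 0 := by
    refine G.eq_zero_of_mem_dir ?_ (G.dir₂.sub_mem (G.sub_mem_dir₂ h h₁) (G.sub_mem_dir₂ h₂ hcd))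
    rw [sub_sub_sub_comm]
    exact G.dir₁.sub_mem (G.sub_mem_dir₁ h h₂) (G.sub_mem_dir₁ h₁ hcd)
  have hpt : ∀ e : M.E, charVec M.E (G.base c d) e + charVec M.E (G.base c' d') e =
      charVec M.E (G.base c d') e + charVec M.E (G.base c' d) e := fun e => by
    have := congrFun hzero e
    simp only [Pi.sub_apply, Pi.zero_apply] at this
    linarith
  have hboth : ∀ e : M.E, (e : α) ∈ G.base c d → (e : α) ∈ G.base c' d' →
      (e : α) ∈ G.base c d' ∧ (e : α) ∈ G.base c' d := fun e he he' => by
    have := hpt e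
    rw [charVec_of_mem he, charVec_of_mem he'] at this
    constructor
    · by_contra hc
      rw [charVec_of_notMem hc] at this
      have := (charVec_mem_Icc (X := M.E) (B := G.base c' d) e trivial).2
      linarith
    · by_contra hc
      rw [charVec_of_notMem hc] at this
      have := (charVec_mem_Icc (X := M.E) (B := G.base c d') e trivial).2
      linarith
  -- Both mixed bases contain `B \ {i}`. The one containing `i` therefore equals `B`, and
  -- injectivity identifies one component.
  by_cases hi₁ : (i : α) ∈ G.base c d'
  · left
    have hsub : G.base c d ⊆ G.base c d' := fun e he => by
      by_cases hei : e = i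
      · exact hei ▸ hi₁
      · exact (hboth ⟨e, hB.subset_ground he⟩ he (hBB' e he hei)).1
    obtain rfl := (G.inj h h₁ (hB.eq_of_subset_isBase (G.isBase h₁) hsub)).2
    exact G.sub_mem_dir₁ hcd h
  · right
    have hi₂ : (i : α) ∈ G.base c' d := by
      by_contra hc
      have := hpt i
      rw [charVec_of_mem hi, charVec_of_notMem hiB', charVec_of_notMem hi₁,
        charVec_of_notMem hc] at this
      norm_num at this
    have hsub : G.base c d ⊆ G.base c' d := fun e he => by
      by_cases hei : e = i
      · exact hei ▸ hi₂
      · exact (hboth ⟨e, hB.subset_ground he⟩ he (hBB' e he hei)).2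
    obtain rfl := (G.inj h h₂ (hB.eq_of_subset_isBase (G.isBase h₂) hsub)).1
    exact G.sub_mem_dir₂ hcd h

/-- If the special row has two values of coefficients, then on a class of elements with the same
coefficient all differences of unit vectors lie in the same direction space. -/
theorem class_mem_dir [M.Finite] [DecidableEq M.E] (hM : IsConnected M) (G : Glued M S₁ x S₂ y)
    {p : M.E → Prop} (hp : ∀ i j, p i → p j →
      (G.row₁ x).linear (Pi.single i 1) = (G.row₁ x).linear (Pi.single j 1)) :
    (∀ i j, p i → p j → (Pi.single i 1 - Pi.single j 1 : M.E → ℝ) ∈ G.dir₁) ∨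
      ∀ i j, p i → p j → (Pi.single i 1 - Pi.single j 1 : M.E → ℝ) ∈ G.dir₂ := by
  have heq : ∀ K : Submodule ℝ (M.E → ℝ), Equivalence fun i j : {e // p e} =>
      (Pi.single i.1 1 - Pi.single j.1 1 : M.E → ℝ) ∈ K := fun K =>
    ⟨fun i => by simp, fun {i j} h => by simpa using K.neg_mem h,
      fun {i j k} h h' => by simpa using K.add_mem h h'⟩
  have := forall_or_forall_of_equivalence (heq G.dir₁) (heq G.dir₂) fun i j => by
    by_cases hij : i = j
    · simp [hij]
    · have hij' : (j.1 : α) ≠ i.1 := fun h => hij (Subtype.ext (Subtype.ext h.symm))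
      obtain ⟨B, hB, hjB, hiB, hB'⟩ := hM.exists_isBase_exchange j.1.2 i.1.2 hij'
      exact G.exchange_mem_dir hB hjB hiB hB' (by rw [map_sub, hp i.1 j.1 i.2 j.2, sub_self])
  rcases this with h | h
  · exact Or.inl fun i j hi hj => h ⟨i, hi⟩ ⟨j, hj⟩
  · exact Or.inr fun i j hi hj => h ⟨i, hi⟩ ⟨j, hj⟩

/-- Pairwise differences in {-1, 0, 1} leave three possible values around any coefficient, and the
outer two differ by 2. A single value would make the row constant on the equicardinal bases. -/
theorem exists_two_values [M.Finite] [Fintype M.E] [DecidableEq M.E] (hM : IsConnected M)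
    (G : Glued M S₁ x S₂ y) (hx : IsSpecialRow S₁ x) (hy : IsSpecialRow S₂ y) :
    ∃ i j : M.E, (G.row₁ x).linear (Pi.single i 1) ≠ (G.row₁ x).linear (Pi.single j 1) ∧
      ∀ e, (G.row₁ x).linear (Pi.single e 1) = (G.row₁ x).linear (Pi.single i 1) ∨
        (G.row₁ x).linear (Pi.single e 1) = (G.row₁ x).linear (Pi.single j 1) := by
  set a : M.E → ℝ := fun e => (G.row₁ x).linear (Pi.single e 1) with ha
  have hdiff : ∀ i j, a j - a i = -1 ∨ a j - a i = 0 ∨ a j - a i = 1 := fun i j => by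
    by_cases hij : i = j
    · simp [hij]
    · obtain ⟨B, hB, hi, hj, hB'⟩ :=
        hM.exists_isBase_exchange i.2 j.2 fun h => hij (Subtype.ext h)
      have h₁ : a j - a i = G.row₁ x (charVec M.E (insert (j : α) (B \ {(i : α)}))) -
          G.row₁ x (charVec M.E B) := by
        rw [← linear_sub, charVec_exchange_sub hi hj, map_sub]
      rw [h₁]
      rcases G.row₁_special_eq hx hB with h | h <;> rcases G.row₁_special_eq hx hB' with h' | h' <;>
        rw [h, h'] <;> norm_num
  have hne : ∃ i j, a i ≠ a j := by
    by_contra! hcon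
    obtain ⟨c₀, hc₀⟩ := hx.2.1
    obtain ⟨c₁, hc₁⟩ := hx.2.2
    obtain ⟨d₀, hd₀⟩ := hy.2.1
    obtain ⟨d₁, hd₁⟩ := hy.2.2
    have h₀ : S₁ x c₀ = S₂ y d₀ := hc₀.trans hd₀.symm
    have h₁ : S₁ x c₁ = S₂ y d₁ := hc₁.trans hd₁.symm
    have hsum := sum_charVec_sub_eq_zero (G.isBase h₁) (G.isBase h₀)
    have hlin := linear_sub (G.row₁ x) (charVec M.E (G.base c₁ d₁)) (charVec M.E (G.base c₀ d₀))
    rw [G.row₁_base x h₁, G.row₁_base x h₀, hc₁, hc₀, linearMap_apply_eq_sum_single] at hlin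
    by_cases hE : Nonempty M.E
    · obtain ⟨e₀⟩ := hE
      have : ∀ e, (G.row₁ x).linear (Pi.single e 1) = a e₀ := fun e => hcon e e₀
      simp only [this] at hlin
      rw [← Finset.sum_mul, hsum] at hlin
      norm_num at hlin
    · rw [not_nonempty_iff] at hE
      simp at hlin
  obtain ⟨i, j, hij⟩ := hne
  refine ⟨i, j, hij, fun e => ?_⟩
  have h₁ := hdiff i j
  have h₂ := hdiff i e
  have h₃ := hdiff j e
  change a e = a i ∨ a e = a j
  have hij' : a j - a i ≠ 0 := fun h => hij (by linarith)
  rcases h₂ with h₂ | h₂ | h₂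
  · rcases h₁ with h₁ | h₁ | h₁
    · right; linarith
    · exact absurd h₁ hij'
    · rcases h₃ with h₃ | h₃ | h₃ <;> linarith
  · left; linarith
  · rcases h₁ with h₁ | h₁ | h₁
    · rcases h₃ with h₃ | h₃ | h₃ <;> linarith
    · exact absurd h₁ hij'
    · right; linarith

/-- The difference of two bases with the same special entry sums to zero on each of the two
classes of elements. -/
theorem sum_class_eq_zero [Fintype M.E] [DecidableEq M.E] (G : Glued M S₁ x S₂ y)
    {p : M.E → Prop} [DecidablePred p] {m m' : ℝ} (hm : m ≠ m')
    (hp : ∀ e, p e → (G.row₁ x).linear (Pi.single e 1) = m)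
    (hp' : ∀ e, ¬ p e → (G.row₁ x).linear (Pi.single e 1) = m') {B B' : Set α} (hB : M.IsBase B)
    (hB' : M.IsBase B') (h : G.row₁ x (charVec M.E B) = G.row₁ x (charVec M.E B')) :
    ∑ e, (if p e then (charVec M.E B - charVec M.E B') e else 0) = 0 := by
  have hlin := linear_sub (G.row₁ x) (charVec M.E B) (charVec M.E B')
  rw [h, sub_self, linearMap_apply_eq_sum_single] at hlin
  have hsum := sum_charVec_sub_eq_zero hB hB'
  set u := charVec M.E B - charVec M.E B'
  have h₁ : ∀ e, u e * (G.row₁ x).linear (Pi.single e 1) =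
      u e * m' + (if p e then u e else 0) * (m - m') := fun e => by
    by_cases he : p e
    · rw [hp e he, if_pos he]; ring
    · rw [hp' e he, if_neg he]; ring
  simp only [h₁, Finset.sum_add_distrib, ← Finset.sum_mul, hsum, zero_mul, zero_add] at hlin
  exact (mul_eq_zero.1 hlin).resolve_right (sub_ne_zero.2 hm)

theorem ite_sub_mem [Fintype M.E] [DecidableEq M.E] (G : Glued M S₁ x S₂ y)
    {p : M.E → Prop} [DecidablePred p] {m m' : ℝ} (hm : m ≠ m')
    (hp : ∀ e, p e → (G.row₁ x).linear (Pi.single e 1) = m)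
    (hp' : ∀ e, ¬ p e → (G.row₁ x).linear (Pi.single e 1) = m') {K : Submodule ℝ (M.E → ℝ)}
    (hK : ∀ i j, p i → p j → (Pi.single i 1 - Pi.single j 1 : M.E → ℝ) ∈ K) {c : κ₁} {d d' : κ₂}
    (h : S₁ x c = S₂ y d) (h' : S₁ x c = S₂ y d') :
    (fun e => if p e then
      (charVec M.E (G.base c d) - charVec M.E (G.base c d')) e else 0) ∈ K :=
  mem_of_single_sub_single_mem hK (fun e he => if_neg he)
    (G.sum_class_eq_zero hm hp hp' (G.isBase h) (G.isBase h')
      (by rw [G.row₁_base x h, G.row₁_base x h']))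

/-- The difference of the two bases lies in `dir₂`, and so does its part outside the class. Its part
on the class is then in `dir₂` as well as in `dir₁`, hence zero. -/
theorem mem_base_iff_of_class [Fintype M.E] [DecidableEq M.E] (G : Glued M S₁ x S₂ y)
    {p : M.E → Prop} {m m' : ℝ} (hm : m ≠ m')
    (hp : ∀ e, p e → (G.row₁ x).linear (Pi.single e 1) = m)
    (hp' : ∀ e, ¬ p e → (G.row₁ x).linear (Pi.single e 1) = m')
    (hK₁ : ∀ i j, p i → p j → (Pi.single i 1 - Pi.single j 1 : M.E → ℝ) ∈ G.dir₁)
    (hK₂ : ∀ i j, ¬ p i → ¬ p j → (Pi.single i 1 - Pi.single j 1 : M.E → ℝ) ∈ G.dir₂)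
    {c : κ₁} {d d' : κ₂} (h : S₁ x c = S₂ y d) (h' : S₁ x c = S₂ y d') {e : M.E} (he : p e) :
    (e : α) ∈ G.base c d ↔ (e : α) ∈ G.base c d' := by
  classical
  have h₁ := G.ite_sub_mem hm hp hp' hK₁ h h'
  have h₂ := G.ite_sub_mem (p := fun e => ¬ p e) hm.symm hp' (by simpa using hp) hK₂ h h'
  have h₃ := G.sub_mem_dir₂ h h'
  rw [← ite_add_ite_not p (charVec M.E (G.base c d) - charVec M.E (G.base c d'))] at h₃
  have h₄ := congrFun (G.eq_zero_of_mem_dir h₁ ((G.dir₂.add_mem_iff_left h₂).1 h₃)) e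
  simp only [he, if_true, Pi.sub_apply, Pi.zero_apply, sub_eq_zero] at h₄
  rw [← charVec_eq_one_iff, h₄, charVec_eq_one_iff]

/-- Both parts of the difference of `B(c,d)` and `B(c,d')` lie in `dir₁`, while the whole lies in
`dir₂`, so the bases coincide. -/
theorem eq_of_classes [Fintype M.E] [DecidableEq M.E] (G : Glued M S₁ x S₂ y)
    (hx : IsSpecialRow S₁ x) (hy : IsSpecialRow S₂ y) {p : M.E → Prop} {m m' : ℝ} (hm : m ≠ m')
    (hp : ∀ e, p e → (G.row₁ x).linear (Pi.single e 1) = m)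
    (hp' : ∀ e, ¬ p e → (G.row₁ x).linear (Pi.single e 1) = m')
    (hK : ∀ i j, p i → p j → (Pi.single i 1 - Pi.single j 1 : M.E → ℝ) ∈ G.dir₁)
    (hK' : ∀ i j, ¬ p i → ¬ p j → (Pi.single i 1 - Pi.single j 1 : M.E → ℝ) ∈ G.dir₁)
    {d d' : κ₂} (hd : S₂ y d = S₂ y d') : d = d' := by
  classical
  obtain ⟨c, h⟩ : ∃ c, S₁ x c = S₂ y d := by
    rcases hy.1 d with h | h <;> rw [h]
    exacts [hx.2.1, hx.2.2]
  have h' := h.trans hd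
  have h₁ := G.ite_sub_mem hm hp hp' hK h h'
  have h₂ := G.ite_sub_mem (p := fun e => ¬ p e) hm.symm hp' (by simpa using hp) hK' h h'
  have h₃ := G.dir₁.add_mem h₁ h₂
  rw [ite_add_ite_not] at h₃
  have h₄ := sub_eq_zero.1 (G.eq_zero_of_mem_dir h₃ (G.sub_mem_dir₂ h h'))
  exact (G.inj h h' (eq_of_charVec_eq (G.isBase h).subset_ground (G.isBase h').subset_ground
    h₄)).2

theorem exists_twoSum_of_classes [M.Finite] [Fintype M.E] [DecidableEq M.E] [Finite ι₁]
    [Finite ι₂] (hM : IsConnected M) (G : Glued M S₁ x S₂ y) (hx : IsSpecialRow S₁ x)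
    (hy : IsSpecialRow S₂ y) {p : M.E → Prop} {m m' : ℝ} (hm : m ≠ m')
    (hp : ∀ e, p e → (G.row₁ x).linear (Pi.single e 1) = m)
    (hp' : ∀ e, ¬ p e → (G.row₁ x).linear (Pi.single e 1) = m') {i j : M.E} (hi : ¬ p i)
    (hj : p j)
    (hK₁ : ∀ i j, p i → p j → (Pi.single i 1 - Pi.single j 1 : M.E → ℝ) ∈ G.dir₁)
    (hK₂ : ∀ i j, ¬ p i → ¬ p j → (Pi.single i 1 - Pi.single j 1 : M.E → ℝ) ∈ G.dir₂) :
    ∃ M₁ M₂ : Matroid (Option α),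
      IsTwoSum (M.mapEmbedding Function.Embedding.some) M₁ M₂ none ∧
      IsSlackMatrix (addComplRow S₁ x) (basePolytope M₁) ∧
      IsSlackMatrix (addComplRow S₂ y) (basePolytope M₂) := by
  have hij : i ≠ j := fun h => hi (h ▸ hj)
  obtain ⟨B, hB, hiB, hjB, hB'⟩ :=
    hM.exists_isBase_exchange i.2 j.2 fun h => hij (Subtype.ext h)
  have hmemA : ∀ e : M.E, (e : α) ∈ Subtype.val '' {e : M.E | p e} ↔ p e := fun e => by simp
  refine G.exists_twoSum_of_split hx hy (A := Subtype.val '' {e : M.E | p e}) ?_ hB hB' hiB hjB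
    (by rwa [hmemA]) (by rwa [hmemA]) ?_ ?_ ?_
  · rintro _ ⟨e, -, rfl⟩
    exact e.2
  · intro h
    have h₁ := linear_sub (G.row₁ x) (charVec M.E (insert (j : α) (B \ {(i : α)})))
      (charVec M.E B)
    rw [charVec_exchange_sub hiB hjB, h, sub_self, map_sub, hp j hj, hp' i hi] at h₁
    exact hm (sub_eq_zero.1 h₁)
  · rintro c d d' h h' _ ⟨e, he, rfl⟩
    exact G.mem_base_iff_of_class hm hp hp' hK₁ hK₂ h h' he
  · intro c c' d h h' e he heA
    refine G.swap.mem_base_iff_of_class (p := fun e => ¬ p e) hm.symm ?_ ?_ hK₂ ?_ h.symm h'.symm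
      (e := ⟨e, he⟩) (by rwa [← hmemA])
    · intro e he
      change (G.row₂ y).linear _ = _
      rw [← G.row_eq]
      exact hp' e he
    · intro e he
      change (G.row₂ y).linear _ = _
      rw [← G.row_eq]
      exact hp e (not_not.1 he)
    · intro i j hi hj
      exact hK₁ i j (not_not.1 hi) (not_not.1 hj)

end Glued

end TwoProd

/-! ### The four cases -/

/-- The matroid `M` is viewed in `Option α`, so that `none` serves as the new element `p ∉ E`. -/
theorem lemma4p4 {α ι κ ι₁ κ₁ ι₂ κ₂ : Type*}
    [Finite ι] [Finite κ] [Finite ι₁] [Finite κ₁] [Finite ι₂] [Finite κ₂]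
    (M : Matroid α) [M.Finite] (hM : TwoProd.IsConnected M)
    (S : Matrix ι κ ℝ) (hS : TwoProd.IsSlackMatrix S (TwoProd.basePolytope M))
    (S₁ : Matrix ι₁ κ₁ ℝ) (x₁ : ι₁) (S₂ : Matrix ι₂ κ₂ ℝ) (y₁ : ι₂)
    (hprod : TwoProd.IsTwoProduct S S₁ x₁ S₂ y₁) :
    ∃ M₁ M₂ : Matroid (Option α),
      TwoProd.IsTwoSum (M.mapEmbedding Function.Embedding.some) M₁ M₂ none ∧
      TwoProd.IsSlackMatrix (TwoProd.addComplRow S₁ x₁) (TwoProd.basePolytope M₁) ∧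
      TwoProd.IsSlackMatrix (TwoProd.addComplRow S₂ y₁) (TwoProd.basePolytope M₂) := by
  classical
  obtain ⟨hx, hy, hiso⟩ := hprod
  obtain ⟨G⟩ := hS.nonempty_glued hiso
  have : Finite M.E := M.ground_finite
  have := Fintype.ofFinite M.E
  obtain ⟨i, j, hij, hval⟩ := G.exists_two_values hM hx hy
  let p : M.E → Prop := fun e =>
    (G.row₁ x₁).linear (Pi.single e 1) = (G.row₁ x₁).linear (Pi.single j 1)
  have hp' : ∀ e, ¬ p e →
      (G.row₁ x₁).linear (Pi.single e 1) = (G.row₁ x₁).linear (Pi.single i 1) :=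
    fun e he => (hval e).resolve_right he
  obtain ⟨B, hB, hiB, hjB, hB'⟩ := hM.exists_isBase_exchange i.2 j.2 fun h =>
    hij (by rw [Subtype.ext h])
  have hrow : G.swap.row₁ y₁ = G.row₁ x₁ := G.row_eq.symm
  -- By definition `dir₂` is the `dir₁` of `G.swap`, so the last two cases are the first two with
  -- the factors exchanged.
  rcases G.class_mem_dir hM (p := p) (fun _ _ h h' => h.trans h'.symm) with hK | hK <;>
    rcases G.class_mem_dir hM (p := fun e => ¬ p e)
      (fun e e' h h' => (hp' e h).trans (hp' e' h').symm) with hK' | hK'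
  · exact G.exists_twoSum_of_two_columns hx hy hB hB' hiB hjB
      fun d d' h => G.eq_of_classes hx hy hij.symm (fun _ h => h) hp' hK hK' h
  · exact G.exists_twoSum_of_classes hM hx hy hij.symm (fun _ h => h) hp' hij rfl hK hK'
  · obtain ⟨M₂, M₁, h, h₂, h₁⟩ := G.swap.exists_twoSum_of_classes hM hy hx (p := p) hij.symm
      (fun e he => by rw [hrow]; exact he) (fun e he => by rw [hrow]; exact hp' e he) hij rfl hK hK'
    exact ⟨M₁, M₂, h.symm, h₁, h₂⟩
  · obtain ⟨M₂, M₁, h, h₂, h₁⟩ := G.swap.exists_twoSum_of_two_columns hy hx hB hB' hiB hjB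
      fun d d' h => G.swap.eq_of_classes hy hx (p := p) hij.symm
        (fun e he => by rw [hrow]; exact he) (fun e he => by rw [hrow]; exact hp' e he) hK hK' h
    exact ⟨M₁, M₂, h.symm, h₁, h₂⟩
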